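/- Let $n \ge 0$, $p, q \ge 1$ be integers and let $G = \mathrm{GL}_n(\mathbb{C})$ act on $W = \mathrm{M}_{n,p}(\mathbb{C}) \oplus \mathrm{M}_{q,n}(\mathbb{C}) \oplus \mathrm{M}_n(\mathbb{C})$ by $g\cdot(B,C,A) = (gB,\, Cg^{-1},\, gAg^{-1})$. Let $\mathfrak{N}(W) = \{w \in W : 0 \in \overline{G\cdot w}\}$ be the null cone (Zariski closure); orbits contained in it are called nilpotent. For $0 \le k \le n$ let $U_k \subset W$ be the subspace of all $(\xi,\eta,v)$ such that $\xi_{ij} = 0$ for $i > k$, $\eta_{ij} = 0$ for $j \le k$, and $v$ is strictly upper triangular, and let $C_k = G\cdot U_k \subset \mathfrak{N}(W)$ (the $C_k$ are the irreducible components of $\mathfrak{N}(W)$). (1) The largest dimension of a nilpotent orbit in $C_k$ is $n^2 - \min\{k, n-k\}$. (2) Put $m = kp + q(n-k) - \max\{k, n-k\}$. There are a Zariski open dense subset $\Omega \subset C_k$ and a regular map $f : \Omega \to \mathbb{C}^m$ such that every fiber of $f$ is a single nilpotent $G$-orbit in $C_k$ of the largest dimension $n^2 - \min\{k, n-k\}$,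 and these orbits are isomorphic to one another and form a fibration: there is an orbit $\mathbb{O} \subset C_k$ such that every point of $\mathbb{C}^m$ has a Zariski open neighbourhood $N$ with a $G$-equivariant isomorphism of varieties $\mathbb{O} \times N \cong f^{-1}(N)$ over $N$. (3) In particular, $C_k$ contains a nilpotent orbit of dimension $n^2$ if and only if $k = 0$ or $k = n$. -/

import Mathlib

namespace EnhancedAdjoint

/-! ### Zariski geometry in a complex vector space

All varieties below are subsets (locally closed, in the applications) of finite-dimensional
complex vector spaces. -/

section Zariski

variable {X Y : Type*} [AddCommGroup X] [Module ℂ X] [AddCommGroup Y] [Module ℂ Y]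

/-- The algebra `ℂ[X]` of polynomial functions on the vector space `X`: the algebra of functions
generated by the linear forms. -/
def polyFun (X : Type*) [AddCommGroup X] [Module ℂ X] : Subalgebra ℂ (X → ℂ) :=
  Algebra.adjoin ℂ (Set.range fun l : Module.Dual ℂ X => (l : X → ℂ))

/-- The Zariski closure of `S`: the common zeros of the polynomial functions vanishing on `S`. -/
def zariskiClosure (S : Set X) : Set X :=
  {x | ∀ f ∈ polyFun X, (∀ y ∈ S, f y = 0) → f x = 0}

/-- `U` is a Zariski open subset of the subspace `S`: it is the complement in `S` of the zero
locus of a set of polynomial functions. -/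
def IsZariskiOpenIn (S U : Set X) : Prop :=
  ∃ F : Set (X → ℂ), F ⊆ polyFun X ∧ U = {x ∈ S | ∃ f ∈ F, f x ≠ 0}

/-- The algebra of restrictions to `S` of polynomial functions, that is
`ℂ[X] / I(S)`, the coordinate ring of the Zariski closure of `S`. -/
def coordRing (S : Set X) : Subalgebra ℂ (S → ℂ) :=
  Algebra.adjoin ℂ (Set.range fun (l : Module.Dual ℂ X) (x : S) => l x)

/-- The dimension of a locally closed set `S`: the transcendence degree over `ℂ` of the
coordinate ring of its closure (equivalently, if `S` is irreducible, of its function field). -/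
noncomputable def varDim (S : Set X) : Cardinal :=
  Algebra.trdeg ℂ (coordRing S)

/-- A function is regular on `S` if, locally for the Zariski topology of `S`, it is a quotient of
two polynomial functions. -/
def IsRegularFunOn (S : Set X) (f : X → ℂ) : Prop :=
  ∀ x ∈ S, ∃ P ∈ polyFun X, ∃ Q ∈ polyFun X,
    Q x ≠ 0 ∧ ∀ y ∈ S, Q y ≠ 0 → f y = P y / Q y

/-- A map to a vector space is regular on `S` if all its coordinates are. -/
def IsRegularOn (S : Set X) (F : X → Y) : Prop :=
  ∀ l : Module.Dual ℂ Y, IsRegularFunOn S fun x => l (F x)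

/-- `F` restricts to an isomorphism of varieties from `S` onto `T`. -/
def IsVarIsoOn (S : Set X) (T : Set Y) (F : X → Y) : Prop :=
  IsRegularOn S F ∧ Set.MapsTo F S T ∧
    ∃ F' : Y → X, IsRegularOn T F' ∧ Set.MapsTo F' T S ∧ Set.InvOn F' F S T

end Zariski

/-! ### The enhanced adjoint representation -/

/-- `W = M_{n,p} ⊕ M_{q,n} ⊕ M_n`. -/
abbrev W (n p q : ℕ) : Type :=
  Matrix (Fin n) (Fin p) ℂ × Matrix (Fin q) (Fin n) ℂ × Matrix (Fin n) (Fin n) ℂ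

variable {n p q : ℕ}

/-- The action `g · (B, C, A) = (g B, C g⁻¹, g A g⁻¹)` of `GL_n(ℂ)` on `W`. -/
def act (g : Matrix.GeneralLinearGroup (Fin n) ℂ) (w : W n p q) : W n p q :=
  ((g : Matrix (Fin n) (Fin n) ℂ) * w.1,
   w.2.1 * ((g⁻¹ : Matrix.GeneralLinearGroup (Fin n) ℂ) : Matrix (Fin n) (Fin n) ℂ),
   (g : Matrix (Fin n) (Fin n) ℂ) * w.2.2 *
     ((g⁻¹ : Matrix.GeneralLinearGroup (Fin n) ℂ) : Matrix (Fin n) (Fin n) ℂ))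

/-- The orbit of `w`. -/
def orbit (w : W n p q) : Set (W n p q) :=
  Set.range fun g : Matrix.GeneralLinearGroup (Fin n) ℂ => act g w

/-- The null cone: the nilpotent elements of `W`, those whose orbit closure contains `0`. -/
def nullCone (n p q : ℕ) : Set (W n p q) :=
  {w | (0 : W n p q) ∈ zariskiClosure (orbit w)}

/-- The maximal unstable subspace `U_k` of all `(ξ, η, v)` such that only the first `k` rows of
`ξ` and only the last `n - k` columns of `η` may be nonzero, and `v` is strictly upper
triangular. -/
def unstable (n p q k : ℕ) : Set (W n p q) :=
  {w | (∀ (i : Fin n) (j : Fin p), k ≤ (i : ℕ) → w.1 i j = 0) ∧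
       (∀ (i : Fin q) (j : Fin n), (j : ℕ) < k → w.2.1 i j = 0) ∧
       (∀ i j : Fin n, j ≤ i → w.2.2 i j = 0)}

/-- The component `C_k = GL_n · U_k` of the null cone. -/
def component (n p q k : ℕ) : Set (W n p q) :=
  {x | ∃ (g : Matrix.GeneralLinearGroup (Fin n) ℂ), ∃ w ∈ unstable n p q k, x = act g w}

/-- `f` makes the `GL_n`-stable subset `Ω` of `W` a fiber bundle over the vector space `M`, with
typical fiber the `GL_n`-stable set `O`: `f` is a regular map, and over a Zariski open
neighborhood `N` of each point of `M` there is a `GL_n`-equivariant isomorphism of varieties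
`O × N ≅ f⁻¹(N)` compatible with the projections to `N`. -/
def IsFibration {M : Type*} [AddCommGroup M] [Module ℂ M]
    (Ω : Set (W n p q)) (f : W n p q → M) (O : Set (W n p q)) : Prop :=
  IsRegularOn Ω f ∧
  ∀ b : M, ∃ N : Set M, b ∈ N ∧ IsZariskiOpenIn Set.univ N ∧
    ∃ e : W n p q × M → W n p q,
      IsVarIsoOn (O ×ˢ N) {x ∈ Ω | f x ∈ N} e ∧
      (∀ x ∈ O, ∀ c ∈ N, f (e (x, c)) = c) ∧
      (∀ (g : Matrix.GeneralLinearGroup (Fin n) ℂ), ∀ x ∈ O, ∀ c ∈ N,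
        e (act g x, c) = act g (e (x, c)))

end EnhancedAdjoint

/-! Transposition combined with reversal of the basis exchanges (p, k) with (q, n - k), so one may
assume n - k ≤ k and, apart from the trivial case n = 0, k ≥ 1. Fix a column z of ξ. At a generic
point of C_k the nilpotent v satisfies v^(n-1) ≠ 0 and column z of v^(k-1) ξ is nonzero. Choose y
such that v^(n-k) y is column z of ξ. Then v^(n-1) y, …, v y, y is a Jordan basis for v in which
column z of ξ becomes the k-th basis vector. This moves the point into `jordanSlice`, an affine
space with k(p-1) + q(n-k) = m coordinates.

An element g carrying one slice point to another commutes with the Jordan block and fixes the k-th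
basis vector. Since n - k ≤ k, it agrees with the identity in the first k columns and in the last n
- k rows, which is all that ξ and η see. Hence the slice points share one stabilizer and lie in
distinct orbits (`jordanSlice_stab`). The saturation of the slice is therefore the product of one
orbit with the slice, and f reads off the slice coordinate (`IsSlice.exists_isFibration`). The
Krylov basis above depends rationally on the point and supplies the local sections (`frame_spec`).
The saturation is a nonvanishing locus in C_k (`mem_saturation_iff`), and it is dense because a
polynomial restricted to a line has finitely many zeros unless it is zero.

For dimensions, the coordinate ring of the orbit of w embeds in the function field K of GL_n as
`orbitRing w`, so the orbit has dimension n² minus the transcendence degree of K over it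
(`varDim_orbit_add`). On the slice this degree is at most n - k, because K becomes algebraic after
adjoining n - k entries of the generic matrix (`trdeg_orbitRing_le`). Conversely, every point of U_k
has an infinitesimal stabilizer containing min(k, n-k) independent matrices X_a
(`exists_linearIndependent_stabilizer`). Translating the generic matrix by 1 + Σ t_a X_a fixes
`orbitRing w` and forces the degree to be at least min(k, n-k) (`le_trdeg_orbitRing`).

Nilpotency is automatic, since a one-parameter subgroup contracts U_k to 0. The last claim holds
because min(k, n-k) vanishes exactly for k = 0 and k = n. -/

namespace EnhancedAdjoint

/-! ### Algebras of polynomial and regular functions -/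

section Functions

variable {X Y : Type*} [AddCommGroup X] [Module ℂ X] [AddCommGroup Y] [Module ℂ Y]

theorem dual_mem_polyFun (l : Module.Dual ℂ X) : (l : X → ℂ) ∈ polyFun X :=
  Algebra.subset_adjoin ⟨l, rfl⟩

/-- Composition with a polynomial map preserves polynomial functions. -/
theorem polyFun_comp {Z : Type*} {B : Subalgebra ℂ (Z → ℂ)} {F : Z → Y}
    (hF : ∀ l : Module.Dual ℂ Y, (fun x => l (F x)) ∈ B) {f : Y → ℂ}
    (hf : f ∈ polyFun Y) : (fun x => f (F x)) ∈ B := by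
  unfold polyFun at hf
  induction hf using Algebra.adjoin_induction with
  | mem f hf => obtain ⟨l, rfl⟩ := hf; exact hF l
  | algebraMap r => exact B.algebraMap_mem r
  | add f g _ _ hf hg => exact B.add_mem hf hg
  | mul f g _ _ hf hg => exact B.mul_mem hf hg

theorem polyFun_comp_linear (F : X →ₗ[ℂ] Y) {f : Y → ℂ} (hf : f ∈ polyFun Y) :
    (fun x => f (F x)) ∈ polyFun X :=
  polyFun_comp (fun l => dual_mem_polyFun (l ∘ₗ F)) hf

/-- The algebra of functions that are, on `S` near `x`, quotients of polynomial functions. -/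
def regAt (S : Set X) (x : X) : Subalgebra ℂ (X → ℂ) where
  carrier := {f | ∃ P ∈ polyFun X, ∃ Q ∈ polyFun X,
    Q x ≠ 0 ∧ ∀ y ∈ S, Q y ≠ 0 → f y = P y / Q y}
  mul_mem' := by
    rintro f g ⟨P, hP, Q, hQ, h0, h⟩ ⟨P', hP', Q', hQ', h0', h'⟩
    refine ⟨P * P', mul_mem hP hP', Q * Q', mul_mem hQ hQ', mul_ne_zero h0 h0', fun y hy hne => ?_⟩
    have h1 := left_ne_zero_of_mul hne
    have h2 := right_ne_zero_of_mul hne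
    simp only [Pi.mul_apply, h y hy h1, h' y hy h2]
    field_simp
  add_mem' := by
    rintro f g ⟨P, hP, Q, hQ, h0, h⟩ ⟨P', hP', Q', hQ', h0', h'⟩
    refine ⟨P * Q' + P' * Q, add_mem (mul_mem hP hQ') (mul_mem hP' hQ), Q * Q', mul_mem hQ hQ',
      mul_ne_zero h0 h0', fun y hy hne => ?_⟩
    have h1 := left_ne_zero_of_mul hne
    have h2 := right_ne_zero_of_mul hne
    simp only [Pi.mul_apply, Pi.add_apply, h y hy h1, h' y hy h2]
    field_simp
  algebraMap_mem' r := ⟨algebraMap ℂ _ r, Subalgebra.algebraMap_mem _ r, 1, one_mem _, by simp,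
    fun y _ _ => by simp⟩

theorem polyFun_le_regAt (S : Set X) (x : X) : polyFun X ≤ regAt S x := fun f hf =>
  ⟨f, hf, 1, one_mem _, by simp, fun y _ _ => by simp⟩

theorem inv_mem_regAt {S : Set X} {x : X} (hx : x ∈ S) {f : X → ℂ} (hf : f ∈ regAt S x)
    (hne : f x ≠ 0) : (fun y => (f y)⁻¹) ∈ regAt S x := by
  obtain ⟨P, hP, Q, hQ, h0, h⟩ := hf
  have hPx : P x ≠ 0 := by
    rw [h x hx h0] at hne
    exact fun h => hne (by simp [h])
  -- The inverse of P / Q is written Q² / (P Q), so that a nonzero denominator also guarantees Q ≠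
  -- 0, where the formula for f is valid.
  refine ⟨Q * Q, mul_mem hQ hQ, P * Q, mul_mem hP hQ, mul_ne_zero hPx h0, fun y hy hne => ?_⟩
  have h1 := left_ne_zero_of_mul hne
  have h2 := right_ne_zero_of_mul hne
  simp only [Pi.mul_apply, h y hy h2]
  field_simp

/-- Multiplying numerator and denominator by q shrinks the neighbourhood to q ≠ 0. Functions defined
by choice are proved regular in this way: near each point they coincide with an explicit formula. -/
theorem regAt_congr {S : Set X} {x : X} {f g : X → ℂ} (hf : f ∈ regAt S x)
    {q : X → ℂ} (hq : q ∈ polyFun X) (hqx : q x ≠ 0) (h : ∀ y ∈ S, q y ≠ 0 → g y = f y) :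
    g ∈ regAt S x := by
  obtain ⟨P, hP, Q, hQ, h0, h'⟩ := hf
  refine ⟨P * q, mul_mem hP hq, Q * q, mul_mem hQ hq, mul_ne_zero h0 hqx, fun y hy hne => ?_⟩
  have h1 := left_ne_zero_of_mul hne
  have h2 := right_ne_zero_of_mul hne
  simp only [Pi.mul_apply, h y hy h2, h' y hy h1]
  field_simp

/-- Pulling back a function that is regular near a point along a linear map. -/
theorem regAt_comp_linear {S : Set X} {T : Set Y} {x : X} (F : X →ₗ[ℂ] Y)
    (hST : Set.MapsTo F S T) {f : Y → ℂ} (hf : f ∈ regAt T (F x)) :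
    (fun y => f (F y)) ∈ regAt S x := by
  obtain ⟨P, hP, Q, hQ, h0, h'⟩ := hf
  exact ⟨_, polyFun_comp_linear F hP, _, polyFun_comp_linear F hQ, h0,
    fun y hy hne => h' _ (hST hy) hne⟩

end Functions

/-! ### Matrix-valued maps with entries in a function algebra -/

section Matrices

variable {X : Type*}

/-- All entries of the matrix valued function `F` belong to the algebra `B`. -/
def MatIn (B : Subalgebra ℂ (X → ℂ)) {a b : Type*} (F : X → Matrix a b ℂ) : Prop :=
  ∀ i j, (fun x => F x i j) ∈ B

namespace MatIn

variable {B : Subalgebra ℂ (X → ℂ)} {a b c : Type*}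

theorem const (A : Matrix a b ℂ) : MatIn B fun _ => A := fun i j => B.algebraMap_mem (A i j)

theorem mul [Fintype b] {F : X → Matrix a b ℂ} {G : X → Matrix b c ℂ} (hF : MatIn B F)
    (hG : MatIn B G) : MatIn B fun x => F x * G x := fun i j => by
  have : (fun x => (F x * G x) i j) = ∑ m, (fun x => F x i m) * fun x => G x m j := by
    ext x; simp [Matrix.mul_apply]
  rw [this]
  exact B.sum_mem fun m _ => B.mul_mem (hF i m) (hG m j)

variable [Fintype a] [DecidableEq a]

theorem pow {F : X → Matrix a a ℂ} (hF : MatIn B F) (N : ℕ) : MatIn B fun x => F x ^ N := by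
  induction N with
  | zero => simpa using MatIn.const (B := B) (1 : Matrix a a ℂ)
  | succ N ih => simpa [pow_succ] using ih.mul hF

theorem det {F : X → Matrix a a ℂ} (hF : MatIn B F) : (fun x => (F x).det) ∈ B := by
  have : (fun x => (F x).det) =
      ∑ σ : Equiv.Perm a, ((σ.sign : ℤ) : ℂ) • ∏ i, fun x => F x (σ i) i := by
    ext x; simp [Matrix.det_apply, Units.smul_def]
  rw [this]
  exact B.sum_mem fun σ _ => B.smul_mem (B.prod_mem fun i _ => hF _ _) _

theorem adjugate {F : X → Matrix a a ℂ} (hF : MatIn B F) : MatIn B fun x => (F x).adjugate := by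
  intro i j
  simp only [Matrix.adjugate_apply]
  refine MatIn.det fun i' j' => ?_
  by_cases h : i' = j
  · subst h
    simp only [Matrix.updateRow_self]
    exact B.algebraMap_mem ((Pi.single i 1 : a → ℂ) j')
  · simpa [Matrix.updateRow_ne h] using hF i' j'

theorem inv {F : X → Matrix a a ℂ} (hF : MatIn B F) (hd : (fun x => ((F x).det)⁻¹) ∈ B) :
    MatIn B fun x => (F x)⁻¹ := by
  intro i j
  simp only [Matrix.inv_def, Ring.inverse_eq_inv', Matrix.smul_apply, smul_eq_mul]
  exact B.mul_mem hd (hF.adjugate i j)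

theorem inv_regAt {X : Type*} [AddCommGroup X] [Module ℂ X] {S : Set X} {x : X} (hx : x ∈ S) {F : X → Matrix a a ℂ}
    (hF : MatIn (regAt S x) F) (hd : IsUnit (F x).det) : MatIn (regAt S x) fun x => (F x)⁻¹ :=
  hF.inv (inv_mem_regAt hx hF.det hd.ne_zero)

end MatIn

theorem dual_matrix_mem {B : Subalgebra ℂ (X → ℂ)} {a b : Type*} [Fintype a] [Fintype b]
    {F : X → Matrix a b ℂ} (hF : MatIn B F) (l : Module.Dual ℂ (Matrix a b ℂ)) :
    (fun x => l (F x)) ∈ B := by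
  classical
  have : (fun x => l (F x)) = ∑ i, ∑ j, l (Matrix.single i j 1) • fun x => F x i j := by
    ext x
    conv_lhs => rw [Matrix.matrix_eq_sum_single (F x)]
    simp only [map_sum, Finset.sum_apply, Pi.smul_apply, smul_eq_mul]
    refine Finset.sum_congr rfl fun i _ => Finset.sum_congr rfl fun j _ => ?_
    rw [mul_comm, ← smul_eq_mul, ← map_smul, Matrix.smul_single, smul_eq_mul, mul_one]
  rw [this]
  exact B.sum_mem fun i _ => B.sum_mem fun j _ => B.smul_mem (hF i j) _

theorem MatIn.mono {B B' : Subalgebra ℂ (X → ℂ)} (h : B ≤ B') {a b : Type*}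
    {F : X → Matrix a b ℂ} (hF : MatIn B F) : MatIn B' F := fun i j => h (hF i j)

end Matrices

/-! ### Linear forms on W and the group action -/

section

variable {n p q : ℕ}

theorem dual_W_mem {X : Type*} {B : Subalgebra ℂ (X → ℂ)} {F : X → W n p q} (h1 : MatIn B fun x => (F x).1)
    (h2 : MatIn B fun x => (F x).2.1) (h3 : MatIn B fun x => (F x).2.2)
    (l : Module.Dual ℂ (W n p q)) : (fun x => l (F x)) ∈ B := by
  have : (fun x => l (F x)) = (fun x => (l ∘ₗ LinearMap.inl ℂ _ _) (F x).1) +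
      ((fun x => (l ∘ₗ LinearMap.inr ℂ _ _ ∘ₗ LinearMap.inl ℂ _ _) (F x).2.1) +
      fun x => (l ∘ₗ LinearMap.inr ℂ _ _ ∘ₗ LinearMap.inr ℂ _ _) (F x).2.2) := by
    ext x
    simp [← map_add]
  rw [this]
  exact B.add_mem (dual_matrix_mem h1 _) (B.add_mem (dual_matrix_mem h2 _) (dual_matrix_mem h3 _))

theorem matIn_linear {X : Type*} [AddCommGroup X] [Module ℂ X] {a b : Type*} (F : X →ₗ[ℂ] Matrix a b ℂ) : MatIn (polyFun X) F := fun i j =>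
  dual_mem_polyFun (⟨⟨fun x => F x i j, by simp⟩, by simp⟩ : Module.Dual ℂ X)

theorem matIn_fst : MatIn (polyFun (W n p q)) fun w => w.1 :=
  matIn_linear (LinearMap.fst ℂ _ _ : W n p q →ₗ[ℂ] _)

theorem matIn_snd_fst : MatIn (polyFun (W n p q)) fun w => w.2.1 :=
  matIn_linear (LinearMap.fst ℂ _ _ ∘ₗ LinearMap.snd ℂ _ _ : W n p q →ₗ[ℂ] _)

theorem matIn_snd_snd : MatIn (polyFun (W n p q)) fun w => w.2.2 :=
  matIn_linear (LinearMap.snd ℂ _ _ ∘ₗ LinearMap.snd ℂ _ _ : W n p q →ₗ[ℂ] _)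

theorem act_mul (g h : Matrix.GeneralLinearGroup (Fin n) ℂ) (w : W n p q) :
    act (g * h) w = act g (act h w) := by
  simp [act, Matrix.mul_assoc, mul_inv_rev]

theorem act_one (w : W n p q) : act 1 w = w := by
  simp [act]

theorem act_inv_act (g : Matrix.GeneralLinearGroup (Fin n) ℂ) (w : W n p q) :
    act g⁻¹ (act g w) = w := by
  rw [← act_mul, inv_mul_cancel, act_one]

theorem act_act_inv (g : Matrix.GeneralLinearGroup (Fin n) ℂ) (w : W n p q) :
    act g (act g⁻¹ w) = w := by
  rw [← act_mul, mul_inv_cancel, act_one]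

theorem orbit_act (g : Matrix.GeneralLinearGroup (Fin n) ℂ) (w : W n p q) :
    orbit (act g w) = orbit w := by
  ext x
  constructor
  · rintro ⟨h, rfl⟩
    exact ⟨h * g, act_mul _ _ _⟩
  · rintro ⟨h, rfl⟩
    exact ⟨h * g⁻¹, by simp only [act_mul, act_inv_act]⟩

end

end EnhancedAdjoint

namespace EnhancedAdjoint

variable {n p q : ℕ}

/-- The action formula for an arbitrary matrix. -/
noncomputable def matAct (g : Matrix (Fin n) (Fin n) ℂ) (w : W n p q) : W n p q :=
  (g * w.1, w.2.1 * g⁻¹, g * w.2.2 * g⁻¹)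

theorem act_eq_matAct (g : Matrix.GeneralLinearGroup (Fin n) ℂ) (w : W n p q) :
    act g w = matAct (g : Matrix (Fin n) (Fin n) ℂ) w := by
  simp [act, matAct, Matrix.coe_units_inv]

theorem act_inv_eq_matAct (g : Matrix.GeneralLinearGroup (Fin n) ℂ) (w : W n p q) :
    act g⁻¹ w = matAct (g : Matrix (Fin n) (Fin n) ℂ)⁻¹ w := by
  rw [act_eq_matAct, Matrix.coe_units_inv]

theorem dual_matAct_mem {X : Type*} {B : Subalgebra ℂ (X → ℂ)}
    {F : X → Matrix (Fin n) (Fin n) ℂ} {w : X → W n p q}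
    (hF : MatIn B F) (hF' : MatIn B fun x => (F x)⁻¹)
    (h1 : MatIn B fun x => (w x).1) (h2 : MatIn B fun x => (w x).2.1)
    (h3 : MatIn B fun x => (w x).2.2) (l : Module.Dual ℂ (W n p q)) :
    (fun x => l (matAct (F x) (w x))) ∈ B :=
  dual_W_mem (F := fun x => matAct (F x) (w x)) (hF.mul h1) (h2.mul hF') ((hF.mul h3).mul hF') l

theorem matIn_entries {X : Type*} {B : Subalgebra ℂ (X → ℂ)} {s : X → W n p q}
    (hs : ∀ l : Module.Dual ℂ (W n p q), (fun c => l (s c)) ∈ B) :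
    MatIn B (fun c => (s c).1) ∧ MatIn B (fun c => (s c).2.1) ∧ MatIn B (fun c => (s c).2.2) :=
  ⟨fun i j => polyFun_comp hs (matIn_fst i j), fun i j => polyFun_comp hs (matIn_snd_fst i j),
    fun i j => polyFun_comp hs (matIn_snd_snd i j)⟩

/-! ### Slices with constant stabilizer and their fiber bundles -/

section Slice

variable {M : Type*} [AddCommGroup M] [Module ℂ M]

/-- The `GL_n`-saturation of the image of `s`. -/
def saturation (s : M → W n p q) : Set (W n p q) := {x | ∃ g c, x = act g (s c)}

/-- A polynomial slice for the `GL_n`-action whose points all have the same stabilizer, with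
local regular sections. -/
structure IsSlice (s : M → W n p q) : Prop where
  poly : ∀ l : Module.Dual ℂ (W n p q), (fun c => l (s c)) ∈ polyFun M
  retract : ∃ ρ : W n p q →ₗ[ℂ] M, ∀ c, ρ (s c) = c
  stab : ∀ g c c', act g (s c) = s c' → ∀ c'', act g (s c'') = s c''
  inj : ∀ g c c', act g (s c) = s c' → c = c'
  localSection : ∀ x₀ ∈ saturation s, ∃ γ : W n p q → Matrix (Fin n) (Fin n) ℂ,
    MatIn (regAt (saturation s) x₀) γ ∧ ∃ Q ∈ polyFun (W n p q), Q x₀ ≠ 0 ∧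
      ∀ x ∈ saturation s, Q x ≠ 0 →
        ∃ g : Matrix.GeneralLinearGroup (Fin n) ℂ,
          (g : Matrix (Fin n) (Fin n) ℂ) = γ x ∧ ∃ c, x = act g (s c)

namespace IsSlice

variable {s : M → W n p q} (hs : IsSlice s)

include hs

theorem eq_param {g g' : Matrix.GeneralLinearGroup (Fin n) ℂ} {c c' : M}
    (h : act g (s c) = act g' (s c')) : c = c' :=
  hs.inj (g'⁻¹ * g) c c' (by rw [act_mul, h, act_inv_act])

/-- g'⁻¹ g maps a slice point to a slice point, hence fixes the whole slice. An arbitrary choice of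
g for each point of the saturation is therefore harmless: its effect on slice points is well
defined. -/
theorem act_eq {g g' : Matrix.GeneralLinearGroup (Fin n) ℂ} {c c' : M}
    (h : act g (s c) = act g' (s c')) (d : M) : act g (s d) = act g' (s d) := by
  have := hs.stab (g'⁻¹ * g) c c' (by rw [act_mul, h, act_inv_act]) d
  calc act g (s d) = act g' (act (g'⁻¹ * g) (s d)) := by rw [← act_mul, mul_inv_cancel_left]
    _ = act g' (s d) := by rw [this]

/-- The saturation of a slice is a trivial fiber bundle of orbits. -/
theorem exists_isFibration (c₀ : M) :
    ∃ f : W n p q → M, IsFibration (saturation s) f (orbit (s c₀)) ∧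
      ∀ b, {x ∈ saturation s | f x = b} = orbit (s b) := by
  classical
  -- Arbitrary choices of g and c with x = g · s(c); the value (1, c₀) off the saturation is a
  -- dummy.
  have hex : ∀ x : W n p q, ∃ gc : Matrix.GeneralLinearGroup (Fin n) ℂ × M,
      x ∈ saturation s → x = act gc.1 (s gc.2) := by
    intro x
    by_cases hx : x ∈ saturation s
    · obtain ⟨g, c, h⟩ := hx
      exact ⟨(g, c), fun _ => h⟩
    · exact ⟨(1, c₀), fun h => absurd h hx⟩
  choose gc hgc using hex
  set G := fun x => (gc x).1 with hG
  set f := fun x => (gc x).2 with hf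
  have hgc : ∀ x ∈ saturation s, x = act (G x) (s (f x)) := hgc
  have hfact : ∀ g c, f (act g (s c)) = c := fun g c =>
    (hs.eq_param (hgc (act g (s c)) ⟨g, c, rfl⟩)).symm
  have hGact : ∀ g c d, act (G (act g (s c))) (s d) = act g (s d) := fun g c d =>
    (hs.act_eq (hgc (act g (s c)) ⟨g, c, rfl⟩) d).symm
  obtain ⟨ρ, hρ⟩ := hs.retract
  have hfreg : ∀ l : Module.Dual ℂ M, ∀ x₀ ∈ saturation s,
      (fun x => l (f x)) ∈ regAt (saturation s) x₀ := by
    intro l x₀ hx₀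
    obtain ⟨γ, hγ, Q, hQ, hQ0, h⟩ := hs.localSection x₀ hx₀
    have hdet : IsUnit (γ x₀).det := by
      obtain ⟨g, hg, -⟩ := h x₀ hx₀ hQ0
      rw [← hg]
      exact (Matrix.isUnit_iff_isUnit_det _).mp g.isUnit
    -- The coordinate is read off from γ(x)⁻¹ · x, and `matAct` inverts its argument once more,
    -- whence the double inverse.
    have hdet' : MatIn (regAt (saturation s) x₀) fun x => ((γ x)⁻¹)⁻¹ :=
      (hγ.inv_regAt hx₀ hdet).inv_regAt hx₀ (Matrix.isUnit_nonsing_inv_det _ hdet)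
    refine regAt_congr (dual_matAct_mem (hγ.inv_regAt hx₀ hdet) hdet'
      (matIn_fst.mono (polyFun_le_regAt _ _)) (matIn_snd_fst.mono (polyFun_le_regAt _ _))
      (matIn_snd_snd.mono (polyFun_le_regAt _ _)) (l ∘ₗ ρ)) hQ hQ0 fun x hx hQx => ?_
    obtain ⟨g, hg, c, rfl⟩ := h x hx hQx
    rw [hfact, ← hg, ← act_inv_eq_matAct, act_inv_act, LinearMap.comp_apply, hρ]
  have hsub : orbit (s c₀) ⊆ saturation s := by
    rintro _ ⟨g, rfl⟩
    exact ⟨g, c₀, rfl⟩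
  -- The bundle is globally trivial, so N is the whole base. The trivialization sends (g · s(c₀), c)
  -- to g · s(c), with inverse g · s(c) ↦ (g · s(c₀), c).
  refine ⟨f, ⟨fun l x hx => hfreg l x hx, fun b => ⟨Set.univ, Set.mem_univ _, ⟨{1}, ?_, ?_⟩,
    fun xc => act (G xc.1) (s xc.2), ⟨?_, ?_, fun x => (act (G x) (s c₀), f x), ?_, ?_, ?_, ?_⟩,
    ?_, ?_⟩⟩, ?_⟩
  · simp
  · simp
  · rintro l ⟨x₀, d⟩ ⟨hx₀, -⟩
    obtain ⟨γ, hγ, Q, hQ, hQ0, h⟩ := hs.localSection x₀ (hsub hx₀)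
    have hdet : IsUnit (γ x₀).det := by
      obtain ⟨g, hg, -⟩ := h x₀ (hsub hx₀) hQ0
      rw [← hg]
      exact (Matrix.isUnit_iff_isUnit_det _).mp g.isUnit
    have hmaps : Set.MapsTo (LinearMap.fst ℂ (W n p q) M) (orbit (s c₀) ×ˢ Set.univ)
        (saturation s) := fun y hy => hsub hy.1
    have hγ' : MatIn (regAt (orbit (s c₀) ×ˢ Set.univ) (x₀, d))
        fun y : W n p q × M => γ y.1 :=
      fun i j => regAt_comp_linear (x := (x₀, d)) (LinearMap.fst ℂ (W n p q) M) hmaps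
        (f := fun x => γ x i j) (hγ i j)
    have hs' := matIn_entries (B := regAt (orbit (s c₀) ×ˢ Set.univ) (x₀, d))
      (s := fun y : W n p q × M => s y.2) fun l => polyFun_le_regAt _ _
        (polyFun_comp_linear (LinearMap.snd ℂ (W n p q) M) (hs.poly l))
    have hmem : (x₀, d) ∈ orbit (s c₀) ×ˢ (Set.univ : Set M) := ⟨hx₀, trivial⟩
    refine regAt_congr (dual_matAct_mem hγ' (hγ'.inv_regAt hmem hdet) hs'.1 hs'.2.1
      hs'.2.2 l) (polyFun_comp_linear (LinearMap.fst ℂ (W n p q) M) hQ) hQ0 ?_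
    rintro ⟨x, e⟩ ⟨hx, -⟩ hQx
    obtain ⟨g, hg, c, hc⟩ := h x (hsub hx) hQx
    subst hc
    simp only [hGact]
    rw [← hg, act_eq_matAct]
  · rintro ⟨x, d⟩ -
    exact ⟨⟨_, _, rfl⟩, trivial⟩
  · rintro l x₀ ⟨hx₀, -⟩
    have hset : {x | x ∈ saturation s ∧ f x ∈ Set.univ} = saturation s := by ext; simp
    change _ ∈ regAt {x | x ∈ saturation s ∧ f x ∈ Set.univ} x₀
    rw [hset]
    obtain ⟨γ, hγ, Q, hQ, hQ0, h⟩ := hs.localSection x₀ hx₀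
    have hdet : IsUnit (γ x₀).det := by
      obtain ⟨g, hg, -⟩ := h x₀ hx₀ hQ0
      rw [← hg]
      exact (Matrix.isUnit_iff_isUnit_det _).mp g.isUnit
    have h1 : (fun x => (l ∘ₗ LinearMap.inl ℂ _ _) (act (G x) (s c₀))) ∈
        regAt (saturation s) x₀ := by
      refine regAt_congr (dual_matAct_mem hγ (hγ.inv_regAt hx₀ hdet) (MatIn.const (s c₀).1)
        (MatIn.const (s c₀).2.1) (MatIn.const (s c₀).2.2) (l ∘ₗ LinearMap.inl ℂ _ _)) hQ hQ0
        fun x hx hQx => ?_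
      obtain ⟨g, hg, c, hc⟩ := h x hx hQx
      subst hc
      simp only [hGact]
      rw [← hg, act_eq_matAct]
    have h2 := hfreg (l ∘ₗ LinearMap.inr ℂ _ _) x₀ hx₀
    have : (fun x => l (act (G x) (s c₀), f x)) =
        (fun x => (l ∘ₗ LinearMap.inl ℂ _ _) (act (G x) (s c₀))) +
          fun x => (l ∘ₗ LinearMap.inr ℂ _ _) (f x) := by
      ext x
      simp [← map_add]
    rw [this]
    exact add_mem h1 h2
  · rintro x -
    exact ⟨⟨_, rfl⟩, trivial⟩
  · rintro ⟨_, d⟩ ⟨⟨g, rfl⟩, -⟩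
    simp only [hGact, hfact]
  · rintro x ⟨hx, -⟩
    simp only [hGact]
    exact (hgc x hx).symm
  · rintro x - c -
    exact hfact _ _
  · rintro g _ ⟨h, rfl⟩ c -
    simp only [hGact, ← act_mul]
  · intro b
    ext x
    constructor
    · rintro ⟨hx, rfl⟩
      exact ⟨G x, (hgc x hx).symm⟩
    · rintro ⟨g, rfl⟩
      exact ⟨⟨g, b, rfl⟩, hfact g b⟩

end IsSlice

end Slice

end EnhancedAdjoint

namespace EnhancedAdjoint

open Matrix

/-! ### Powers of the Jordan block and triangular matrices -/

section Shift

variable {n : ℕ} {R : Type*} [CommRing R]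

/-- The `a`-th power of the nilpotent Jordan block. -/
def shift (n : ℕ) (R : Type*) [CommRing R] (a : ℕ) : Matrix (Fin n) (Fin n) R :=
  Matrix.of fun i j => if (j : ℕ) = i + a then 1 else 0

theorem shift_apply (a : ℕ) (i j : Fin n) :
    shift n R a i j = if (j : ℕ) = i + a then 1 else 0 := rfl

theorem shift_mul_apply {β : Type*} (a : ℕ) (A : Matrix (Fin n) β R) (i : Fin n) (j : β) :
    (shift n R a * A) i j = if h : (i : ℕ) + a < n then A ⟨i + a, h⟩ j else 0 := by
  rw [Matrix.mul_apply]
  split_ifs with h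
  · rw [Finset.sum_eq_single (⟨i + a, h⟩ : Fin n)]
    · simp [shift_apply]
    · intro b _ hb
      rw [shift_apply, if_neg (fun h => hb (Fin.ext h)), zero_mul]
    · simp
  · refine Finset.sum_eq_zero fun b _ => ?_
    rw [shift_apply, if_neg (by omega), zero_mul]

theorem mul_shift_apply {β : Type*} (a : ℕ) (A : Matrix β (Fin n) R) (i : β) (j : Fin n) :
    (A * shift n R a) i j = if h : a ≤ (j : ℕ) then A i ⟨j - a, by omega⟩ else 0 := by
  rw [Matrix.mul_apply]
  split_ifs with h
  · rw [Finset.sum_eq_single (⟨j - a, by omega⟩ : Fin n)]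
    · simp [shift_apply, h]
    · intro b _ hb
      rw [shift_apply, if_neg (fun h => hb (Fin.ext (by simp; omega))), mul_zero]
    · simp
  · refine Finset.sum_eq_zero fun b _ => ?_
    rw [shift_apply, if_neg (by omega), mul_zero]

theorem shift_mul_apply_of_eq {β : Type*} {a : ℕ} (A : Matrix (Fin n) β R) {i i' : Fin n}
    (h : (i' : ℕ) = i + a) (j : β) : (shift n R a * A) i j = A i' j := by
  rw [shift_mul_apply, dif_pos (by omega)]
  exact congrArg (fun x => A x j) (Fin.ext h.symm)

theorem shift_mul_apply_of_le {β : Type*} {a : ℕ} (A : Matrix (Fin n) β R) {i : Fin n}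
    (h : n ≤ i + a) (j : β) : (shift n R a * A) i j = 0 := by
  rw [shift_mul_apply, dif_neg (by omega)]

theorem mul_shift_apply_of_eq {β : Type*} {a : ℕ} (A : Matrix β (Fin n) R) (i : β) {j j' : Fin n}
    (h : (j : ℕ) = j' + a) : (A * shift n R a) i j = A i j' := by
  rw [mul_shift_apply, dif_pos (by omega)]
  exact congrArg (A i) (Fin.ext (by simp; omega))

theorem mul_shift_apply_of_lt {β : Type*} {a : ℕ} (A : Matrix β (Fin n) R) (i : β) {j : Fin n}
    (h : (j : ℕ) < a) : (A * shift n R a) i j = 0 := by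
  rw [mul_shift_apply, dif_neg (by omega)]

theorem shift_zero : shift n R 0 = 1 := by
  ext i j
  simp [shift_apply, Matrix.one_apply, Fin.ext_iff, eq_comm]

theorem shift_mul_shift (a b : ℕ) : shift n R a * shift n R b = shift n R (a + b) := by
  ext i j
  rw [shift_mul_apply]
  split_ifs with h
  · simp [shift_apply, add_assoc]
  · rw [shift_apply, if_neg (by omega)]

theorem shift_pow (a : ℕ) : shift n R 1 ^ a = shift n R a := by
  induction a with
  | zero => simp [shift_zero]
  | succ a ih => rw [pow_succ, ih, shift_mul_shift]

theorem pow_mul_eq_mul_shift {v P : Matrix (Fin n) (Fin n) R} (h : v * P = P * shift n R 1)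
    (a : ℕ) : v ^ a * P = P * shift n R a := by
  induction a with
  | zero => simp [shift_zero]
  | succ a ih =>
    rw [pow_succ, Matrix.mul_assoc, h, ← Matrix.mul_assoc, ih, Matrix.mul_assoc, shift_mul_shift]

/-- `A` vanishes below its `a`-th superdiagonal. -/
def IsUpper (a : ℕ) (A : Matrix (Fin n) (Fin n) R) : Prop :=
  ∀ i j : Fin n, (j : ℕ) < i + a → A i j = 0

theorem IsUpper.mul {a b : ℕ} {A B : Matrix (Fin n) (Fin n) R} (hA : IsUpper a A)
    (hB : IsUpper b B) : IsUpper (a + b) (A * B) := by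
  intro i j h
  rw [Matrix.mul_apply]
  refine Finset.sum_eq_zero fun m _ => ?_
  by_cases hm : (m : ℕ) < i + a
  · rw [hA i m hm, zero_mul]
  · rw [hB m j (by omega), mul_zero]

theorem IsUpper.pow {A : Matrix (Fin n) (Fin n) R} (hA : IsUpper 1 A) (a : ℕ) :
    IsUpper a (A ^ a) := by
  induction a with
  | zero =>
    intro i j h
    rw [pow_zero, Matrix.one_apply_ne]
    rintro rfl
    omega
  | succ a ih => rw [pow_succ]; exact ih.mul hA

theorem isUpper_shift (a : ℕ) : IsUpper a (shift n R a) := fun i j h => by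
  rw [shift_apply, if_neg (by omega)]

/-- A matrix conjugating `v` into a Jordan block is invertible if its first column is nonzero. -/
theorem isUnit_of_mul_eq_mul_shift {F : Type*} [Field F] {v P : Matrix (Fin n) (Fin n) F}
    (h : v * P = P * shift n F 1) (h0 : ∀ i : Fin n, (i : ℕ) = 0 → ∃ a, P a i ≠ 0) :
    IsUnit P := by
  rw [← Matrix.mulVec_injective_iff_isUnit, ← Matrix.coe_mulVecLin, ← LinearMap.ker_eq_bot,
    LinearMap.ker_eq_bot']
  intro u hu
  rw [Matrix.mulVecLin_apply] at hu
  by_contra hne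
  have hex : ∃ b : ℕ, ∃ h : b < n, u ⟨b, h⟩ ≠ 0 := by
    by_contra hcon
    push Not at hcon
    exact hne (funext fun i => hcon i i.2)
  -- Let b be the last nonzero position of a kernel vector u. Applying v^b to P u = 0 shifts
  -- position b to position 0 and kills all earlier ones, leaving u_b times the first column of P.
  obtain ⟨b, ⟨hb, hub⟩, hmax⟩ : ∃ b : ℕ, (∃ h : b < n, u ⟨b, h⟩ ≠ 0) ∧
      ∀ b', b < b' → ∀ h : b' < n, u ⟨b', h⟩ = 0 := by
    classical
    refine ⟨Nat.findGreatest (fun b => ∃ h : b < n, u ⟨b, h⟩ ≠ 0) n, ?_, ?_⟩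
    · obtain ⟨b, hb, hu⟩ := hex
      exact Nat.findGreatest_spec (P := fun b => ∃ h : b < n, u ⟨b, h⟩ ≠ 0) hb.le ⟨hb, hu⟩
    · intro b' hb' h
      by_contra hcon
      exact Nat.findGreatest_is_greatest hb' h.le ⟨h, hcon⟩
  obtain ⟨a, ha⟩ := h0 ⟨0, by omega⟩ rfl
  have h1 : (P * shift n F b) *ᵥ u = 0 := by
    rw [← pow_mul_eq_mul_shift h, ← Matrix.mulVec_mulVec, hu, Matrix.mulVec_zero]
  have h2 : ((P * shift n F b) *ᵥ u) a = P a ⟨0, by omega⟩ * u ⟨b, hb⟩ := by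
    rw [Matrix.mulVec, dotProduct, Finset.sum_eq_single ⟨b, hb⟩]
    · rw [mul_shift_apply, dif_pos (le_refl _)]
      simp
    · intro j _ hj
      rcases lt_trichotomy (j : ℕ) b with h | h | h
      · rw [mul_shift_apply, dif_neg (by omega), zero_mul]
      · exact absurd (Fin.ext h) hj
      · rw [hmax j h j.2, mul_zero]
    · simp
  rw [h1] at h2
  exact mul_ne_zero ha hub h2.symm

end Shift

/-! ### Closed relations satisfied on the component -/

section Component

variable {n p q k : ℕ}

theorem gl_inv_mul_cancel (g : Matrix.GeneralLinearGroup (Fin n) ℂ) {β : Type*}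
    (A : Matrix (Fin n) β ℂ) :
    ((g⁻¹ : Matrix.GeneralLinearGroup (Fin n) ℂ) : Matrix (Fin n) (Fin n) ℂ) *
      ((g : Matrix (Fin n) (Fin n) ℂ) * A) = A := by
  rw [← Matrix.mul_assoc, Units.inv_mul, Matrix.one_mul]

theorem gl_mul_inv_cancel (g : Matrix.GeneralLinearGroup (Fin n) ℂ) {β : Type*}
    (A : Matrix (Fin n) β ℂ) : (g : Matrix (Fin n) (Fin n) ℂ) *
      (((g⁻¹ : Matrix.GeneralLinearGroup (Fin n) ℂ) : Matrix (Fin n) (Fin n) ℂ) * A) = A := by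
  rw [← Matrix.mul_assoc, Units.mul_inv, Matrix.one_mul]

/-- The relations are conjugation invariant, and on U_k they follow from v^a vanishing below the
a-th superdiagonal. They are the only facts about C_k needed to bring a generic point into the
slice. -/
theorem component_relations {w : W n p q} (hw : w ∈ component n p q k) :
    w.2.2 ^ n = 0 ∧ w.2.2 ^ k * w.1 = 0 ∧ w.2.1 * w.2.2 ^ (n - k) = 0 := by
  obtain ⟨g, u, ⟨h1, h2, h3⟩, rfl⟩ := hw
  have hup : IsUpper 1 u.2.2 := fun i j h => h3 i j (by rw [Fin.le_def]; omega)
  have hpow : ∀ a, (act g u).2.2 ^ a = (g : Matrix (Fin n) (Fin n) ℂ) * u.2.2 ^ a *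
      ((g⁻¹ : Matrix.GeneralLinearGroup (Fin n) ℂ) : Matrix (Fin n) (Fin n) ℂ) := by
    intro a
    exact Units.conj_pow g u.2.2 a
  refine ⟨?_, ?_, ?_⟩
  · have : u.2.2 ^ n = 0 := by
      ext i j
      exact hup.pow n i j (by omega)
    rw [hpow, this]
    simp
  · have : u.2.2 ^ k * u.1 = 0 := by
      ext i j
      rw [Matrix.mul_apply]
      refine Finset.sum_eq_zero fun m _ => ?_
      by_cases hm : k ≤ (m : ℕ)
      · rw [h1 m j hm, mul_zero]
      · rw [hup.pow k i m (by omega), zero_mul]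
    rw [hpow]
    simp only [act, Matrix.mul_assoc, gl_inv_mul_cancel]
    rw [this, Matrix.mul_zero]
  · have : u.2.1 * u.2.2 ^ (n - k) = 0 := by
      ext i j
      rw [Matrix.mul_apply]
      refine Finset.sum_eq_zero fun m _ => ?_
      by_cases hm : (m : ℕ) < k
      · rw [h2 i m hm, zero_mul]
      · rw [hup.pow (n - k) m j (by omega), mul_zero]
    rw [hpow]
    simp only [act, Matrix.mul_assoc, gl_inv_mul_cancel]
    rw [← Matrix.mul_assoc, this, Matrix.zero_mul]

end Component

/-- The indices of the free coordinates of the slice. -/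
abbrev SliceIndex (n p q k : ℕ) (z : Fin p) : Type :=
  {i : Fin n // (i : ℕ) < k} × {j : Fin p // j ≠ z} ⊕ Fin q × {j : Fin n // k ≤ (j : ℕ)}

/-! ### The Jordan slice, its stabilizers and its local sections -/

section JordanSlice

variable {n p q k : ℕ} {z : Fin p} {ι : Type*}

/-- The affine space of all `(ξ, η, v)` in the unstable subspace for which `v` is the Jordan block
and the column `z` of `ξ` is the `k`-th basis vector. -/
def jordanSlice (e : ι ≃ SliceIndex n p q k z) (c : ι → ℂ) : W n p q :=
  (Matrix.of fun i j => if h : j = z then (if (i : ℕ) + 1 = k then 1 else 0) else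
      if h' : (i : ℕ) < k then c (e.symm (Sum.inl (⟨i, h'⟩, ⟨j, h⟩))) else 0,
    Matrix.of fun i j => if h : k ≤ (j : ℕ) then c (e.symm (Sum.inr (i, ⟨j, h⟩))) else 0,
    shift n ℂ 1)

variable {e : ι ≃ SliceIndex n p q k z}

theorem jordanSlice_mem_unstable (c : ι → ℂ) : jordanSlice e c ∈ unstable n p q k := by
  refine ⟨fun i j h => ?_, fun i j h => ?_, fun i j h => isUpper_shift 1 i j ?_⟩
  · simp only [jordanSlice, Matrix.of_apply]
    split_ifs <;> first | rfl | omega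
  · simp only [jordanSlice, Matrix.of_apply]
    rw [dif_neg (by omega)]
  · have := Fin.le_def.mp h
    omega

theorem exists_eq_jordanSlice {w : W n p q} (h1 : ∀ (i : Fin n) j, k ≤ (i : ℕ) → w.1 i j = 0)
    (h2 : ∀ i (j : Fin n), (j : ℕ) < k → w.2.1 i j = 0) (h3 : w.2.2 = shift n ℂ 1)
    (h4 : ∀ i, w.1 i z = if (i : ℕ) + 1 = k then 1 else 0) : ∃ c, w = jordanSlice e c := by
  refine ⟨fun a => Sum.elim (fun x => w.1 x.1 x.2) (fun x => w.2.1 x.1 x.2) (e a), ?_⟩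
  refine Prod.ext ?_ (Prod.ext ?_ h3)
  · ext i j
    simp only [jordanSlice, Matrix.of_apply, Equiv.apply_symm_apply, Sum.elim_inl]
    split_ifs with h h' h'
    · rw [h, h4, if_pos h']
    · rw [h, h4, if_neg h']
    · rfl
    · exact h1 i j (not_lt.mp h')
  · ext i j
    simp only [jordanSlice, Matrix.of_apply, Equiv.apply_symm_apply, Sum.elim_inr]
    split_ifs with h
    · rfl
    · exact h2 i j (not_le.mp h)

/-- Matrices fixing a point of the slice fix the whole unstable subspace up to the nilpotent part. -/
theorem apply_eq_one_of_commute (hk : k ≤ n) (hkk : n - k ≤ k) (k1 : 1 ≤ k)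
    {g : Matrix (Fin n) (Fin n) ℂ}
    (hcomm : shift n ℂ 1 * g = g * shift n ℂ 1)
    (hfix : ∀ i j : Fin n, (j : ℕ) + 1 = k → g i j = if i = j then 1 else 0) (i j : Fin n)
    (hij : (j : ℕ) < k ∨ k ≤ (i : ℕ)) : g i j = (1 : Matrix (Fin n) (Fin n) ℂ) i j := by
  have hc : ∀ a, shift n ℂ a * g = g * shift n ℂ a := fun a => by
    rw [← shift_pow]
    exact pow_mul_eq_mul_shift hcomm a ▸ by rw [shift_pow]
  -- Commuting with the shift by k - 1 - j expresses column j through column k - 1 (counted from 0),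
  -- which is prescribed.
  have key : ∀ i j : Fin n, (j : ℕ) < k → g i j = (1 : Matrix (Fin n) (Fin n) ℂ) i j := by
    intro i j hj
    have h := congrFun (congrFun (hc (k - 1 - j)) i) ⟨k - 1, by omega⟩
    rw [mul_shift_apply_of_eq g i (j' := j) (by simp; omega)] at h
    rw [← h, Matrix.one_apply]
    by_cases h1 : (i : ℕ) + (k - 1 - j) < n
    · rw [shift_mul_apply_of_eq g (i' := ⟨i + (k - 1 - j), h1⟩) rfl, hfix _ _ (by simp; omega)]
      simp only [Fin.ext_iff]
      congr 1
      simp only [eq_iff_iff]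
      omega
    · rw [shift_mul_apply_of_le g (by omega), if_neg]
      rintro rfl
      omega
  rcases hij with hj | hi
  · exact key i j hj
  -- Moving n - k steps up the diagonal is possible because i ≥ k ≥ n - k. It either leaves the
  -- matrix on the left, giving 0, or lands in a column j - (n - k) < k already known.
  · have h := congrFun (congrFun (hc (n - k)) ⟨i - (n - k), by omega⟩) j
    rw [shift_mul_apply_of_eq g (i' := i) (by simp; omega)] at h
    rw [h]
    by_cases h1 : n - k ≤ (j : ℕ)
    · rw [mul_shift_apply_of_eq g _ (j' := ⟨j - (n - k), by omega⟩) (by simp; omega),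
        key _ _ (by simp; omega), Matrix.one_apply, Matrix.one_apply]
      simp only [Fin.ext_iff]
      congr 1
      simp only [eq_iff_iff]
      omega
    · rw [mul_shift_apply_of_lt g _ (by omega), Matrix.one_apply_ne]
      rintro rfl
      omega

/-- The third component and column z of the first show that g commutes with the Jordan block and
fixes the k-th basis vector, conditions independent of c. The rows of ξ from k on and the columns of
η before k vanish, so only the part of g equal to the identity acts on them. -/
theorem jordanSlice_stab (hk : k ≤ n) (hkk : n - k ≤ k) (k1 : 1 ≤ k)
    {g : Matrix.GeneralLinearGroup (Fin n) ℂ} {c c' : ι → ℂ}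
    (h : act g (jordanSlice e c) = jordanSlice e c') (d : ι → ℂ) :
    act g (jordanSlice e d) = jordanSlice e d := by
  have h3 : shift n ℂ 1 * (g : Matrix (Fin n) (Fin n) ℂ) = g * shift n ℂ 1 := by
    have := congrArg (fun w => w.2.2 * (g : Matrix (Fin n) (Fin n) ℂ)) h
    simpa [act, jordanSlice, Matrix.mul_assoc] using this.symm
  have hfix : ∀ i j : Fin n, (j : ℕ) + 1 = k →
      (g : Matrix (Fin n) (Fin n) ℂ) i j = if i = j then 1 else 0 := by
    intro i j hj
    have := congrFun (congrFun (congrArg (fun w => w.1) h) i) z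
    simp only [act, jordanSlice, Matrix.mul_apply, Matrix.of_apply, dif_pos] at this
    rw [Finset.sum_eq_single j] at this
    · rw [if_pos hj, mul_one] at this
      rw [this]
      simp only [Fin.ext_iff]
      congr 1
      simp only [eq_iff_iff]
      omega
    · intro b _ hb
      rw [if_neg, mul_zero]
      intro hb'
      exact hb (Fin.ext (by omega))
    · simp
  have key := apply_eq_one_of_commute hk hkk k1 h3 hfix
  have hu := jordanSlice_mem_unstable (e := e) d
  have e1 : (g : Matrix (Fin n) (Fin n) ℂ) * (jordanSlice e d).1 = (jordanSlice e d).1 := by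
    conv_rhs => rw [← Matrix.one_mul (jordanSlice e d).1]
    ext i j
    rw [Matrix.mul_apply, Matrix.mul_apply]
    refine Finset.sum_congr rfl fun m _ => ?_
    by_cases hm : (m : ℕ) < k
    · rw [key i m (Or.inl hm)]
    · rw [hu.1 m j (not_lt.mp hm), mul_zero, mul_zero]
  have e2 : (jordanSlice e d).2.1 * (g : Matrix (Fin n) (Fin n) ℂ) = (jordanSlice e d).2.1 := by
    conv_rhs => rw [← Matrix.mul_one (jordanSlice e d).2.1]
    ext i j
    rw [Matrix.mul_apply, Matrix.mul_apply]
    refine Finset.sum_congr rfl fun m _ => ?_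
    by_cases hm : (m : ℕ) < k
    · rw [hu.2.1 i m hm, zero_mul, zero_mul]
    · rw [key m j (Or.inr (not_lt.mp hm))]
  refine Prod.ext e1 (Prod.ext ?_ ?_)
  · change (jordanSlice e d).2.1 * _ = _
    conv_lhs => rw [← e2]
    rw [Matrix.mul_assoc, Units.mul_inv, Matrix.mul_one]
  · change (g : Matrix (Fin n) (Fin n) ℂ) * shift n ℂ 1 * _ = shift n ℂ 1
    rw [← h3, Matrix.mul_assoc, Units.mul_inv, Matrix.mul_one]

/-- The matrix with columns `v ^ (n - 1) y, …, v y, y`, where `y` is the column `b` of `Y`. -/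
def krylov {β : Type*} (v : Matrix (Fin n) (Fin n) ℂ) (Y : Matrix (Fin n) β ℂ) (b : β) :
    Matrix (Fin n) (Fin n) ℂ :=
  Matrix.of fun i j => (v ^ (n - 1 - (j : ℕ)) * Y) i b

/-- Multiplication by v replaces each column by its left neighbour and kills the first one, which is
v^(n-1) y. -/
theorem mul_krylov {β : Type*} {v : Matrix (Fin n) (Fin n) ℂ} (hv : v ^ n = 0)
    (Y : Matrix (Fin n) β ℂ) (b : β) : v * krylov v Y b = krylov v Y b * shift n ℂ 1 := by
  ext i j
  have h : (v * krylov v Y b) i j = (v ^ (n - 1 - (j : ℕ) + 1) * Y) i b := by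
    rw [pow_succ', Matrix.mul_assoc, Matrix.mul_apply, Matrix.mul_apply]
    rfl
  rw [h, mul_shift_apply]
  split_ifs with hj
  · simp only [krylov, Matrix.of_apply]
    rw [show n - 1 - (j : ℕ) + 1 = n - 1 - ((j : ℕ) - 1) by omega]
  · have := j.isLt
    rw [show n - 1 - (j : ℕ) + 1 = n by omega, hv]
    simp

theorem isUnit_krylov {β : Type*} {v : Matrix (Fin n) (Fin n) ℂ} (hv : v ^ n = 0)
    {Y : Matrix (Fin n) β ℂ} {b : β} {a : Fin n} (h : (v ^ (n - 1) * Y) a b ≠ 0) :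
    IsUnit (krylov v Y b) := by
  refine isUnit_of_mul_eq_mul_shift (mul_krylov hv Y b) fun i hi => ⟨a, ?_⟩
  simpa [krylov, hi] using h

/-- A solution `Y` of `v ^ (n - k) Y = ξ`. -/
noncomputable def krylovLift (k : ℕ) (P : Matrix (Fin n) (Fin n) ℂ) {β : Type*}
    (ξ : Matrix (Fin n) β ℂ) : Matrix (Fin n) β ℂ :=
  P * ((shift n ℂ (n - k))ᵀ * (P⁻¹ * ξ))

/-- In the Jordan basis P, the kernel of the k-th power of the block equals the image of its (n -
k)-th power, and the transposed shift is a right inverse there. -/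
theorem pow_mul_lift (hk : k ≤ n) {β : Type*} {v P : Matrix (Fin n) (Fin n) ℂ} (hP : IsUnit P)
    (hvP : v * P = P * shift n ℂ 1) {ξ : Matrix (Fin n) β ℂ} (hξ : v ^ k * ξ = 0) :
    v ^ (n - k) * krylovLift k P ξ = ξ := by
  have hdet := (Matrix.isUnit_iff_isUnit_det _).mp hP
  have h0 : shift n ℂ k * (P⁻¹ * ξ) = 0 := by
    have : P * (shift n ℂ k * (P⁻¹ * ξ)) = 0 := by
      rw [← Matrix.mul_assoc, ← pow_mul_eq_mul_shift hvP, Matrix.mul_assoc,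
        Matrix.mul_nonsing_inv_cancel_left _ _ hdet, hξ]
    rw [← Matrix.nonsing_inv_mul_cancel_left _ (shift n ℂ k * (P⁻¹ * ξ)) hdet, this,
      Matrix.mul_zero]
  rw [krylovLift, ← Matrix.mul_assoc, pow_mul_eq_mul_shift hvP, Matrix.mul_assoc]
  have h1 : shift n ℂ (n - k) * ((shift n ℂ (n - k))ᵀ * (P⁻¹ * ξ)) = P⁻¹ * ξ := by
    ext i j
    rw [shift_mul_apply]
    split_ifs with h
    · rw [Matrix.mul_apply, Finset.sum_eq_single i]
      · simp [shift_apply]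
      · intro b _ hb
        rw [Matrix.transpose_apply, shift_apply, if_neg, zero_mul]
        intro h
        exact hb (Fin.ext (by simp at h; omega))
      · simp
    · have := congrFun (congrFun h0 ⟨i - k, by omega⟩) j
      rw [shift_mul_apply_of_eq _ (i' := i) (by simp; omega)] at this
      exact this.symm
  rw [h1, Matrix.mul_nonsing_inv_cancel_left _ _ hdet]

/-- The local section of the saturation of the slice. -/
noncomputable def frame (k : ℕ) (z : Fin p) (b : Fin n) (x : W n p q) :
    Matrix (Fin n) (Fin n) ℂ :=
  krylov x.2.2 (krylovLift k (krylov x.2.2 (1 : Matrix (Fin n) (Fin n) ℂ) b) x.1) z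

/-- The frame has columns v^(n-1) y, …, y with v^(n-k) y equal to column z of ξ, so that vector is
column k - 1 (counted from 0) of the frame. In this basis v is the Jordan block, column z is
normalized, and the two remaining relations become the vanishing pattern of U_k. The auxiliary basis
`P` serves only to find y by a rational formula. -/
theorem frame_spec (hk : k ≤ n) (k1 : 1 ≤ k) {x : W n p q} {a b d : Fin n}
    (h1 : x.2.2 ^ n = 0) (h2 : x.2.2 ^ k * x.1 = 0) (h3 : x.2.1 * x.2.2 ^ (n - k) = 0)
    (h4 : (x.2.2 ^ (n - 1)) a b ≠ 0) (h5 : (x.2.2 ^ (k - 1) * x.1) d z ≠ 0) :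
    ∃ g : Matrix.GeneralLinearGroup (Fin n) ℂ,
      (g : Matrix (Fin n) (Fin n) ℂ) = frame k z b x ∧ ∃ c, x = act g (jordanSlice e c) := by
  set P := krylov x.2.2 (1 : Matrix (Fin n) (Fin n) ℂ) b with hP
  have hPu : IsUnit P := isUnit_krylov h1 (a := a) (by simpa using h4)
  have hlift : x.2.2 ^ (n - k) * krylovLift k P x.1 = x.1 :=
    pow_mul_lift hk hPu (mul_krylov h1 _ _) h2
  have hu : IsUnit (frame k z b x) := by
    refine isUnit_krylov h1 (a := d) ?_
    -- The first column of the frame is v^(k-1) v^(n-k) y, that is, column z of v^(k-1) ξ, nonzero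
    -- by hypothesis.
    rw [show n - 1 = (k - 1) + (n - k) by omega, pow_add, Matrix.mul_assoc, ← hP, hlift]
    exact h5
  have hcomm : x.2.2 * frame k z b x = frame k z b x * shift n ℂ 1 := mul_krylov h1 _ _
  obtain ⟨g, hg⟩ := hu
  refine ⟨g, hg, ?_⟩
  rw [← hg] at hcomm
  have hpow := pow_mul_eq_mul_shift hcomm
  have e3 : (act g⁻¹ x).2.2 = shift n ℂ 1 := by
    change ((g⁻¹ : Matrix.GeneralLinearGroup (Fin n) ℂ) : Matrix (Fin n) (Fin n) ℂ) * x.2.2 *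
      ((g⁻¹⁻¹ : Matrix.GeneralLinearGroup (Fin n) ℂ) : Matrix (Fin n) (Fin n) ℂ) = _
    rw [inv_inv, Matrix.mul_assoc, hcomm, gl_inv_mul_cancel]
  have hmem : ∃ c, act g⁻¹ x = jordanSlice e c := by
    refine exists_eq_jordanSlice ?_ ?_ e3 ?_
    · intro i j hi
      -- In the new basis v^k ξ = 0 says that row i + k of ξ vanishes for every i.
      have : shift n ℂ k * (act g⁻¹ x).1 = 0 := by
        have h : (g : Matrix (Fin n) (Fin n) ℂ) * (shift n ℂ k * (act g⁻¹ x).1) = 0 := by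
          rw [← Matrix.mul_assoc, ← hpow]
          simp only [act, Matrix.mul_assoc, gl_mul_inv_cancel]
          exact h2
        rw [← gl_inv_mul_cancel g (shift n ℂ k * (act g⁻¹ x).1), h, Matrix.mul_zero]
      have := congrFun (congrFun this ⟨i - k, by omega⟩) j
      rwa [shift_mul_apply_of_eq _ (i' := i) (by simp; omega)] at this
    · intro i j hj
      have : (act g⁻¹ x).2.1 * shift n ℂ (n - k) = 0 := by
        change x.2.1 * ((g⁻¹⁻¹ : Matrix.GeneralLinearGroup (Fin n) ℂ) :
          Matrix (Fin n) (Fin n) ℂ) * shift n ℂ (n - k) = 0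
        rw [inv_inv, Matrix.mul_assoc, ← hpow, ← Matrix.mul_assoc, h3, Matrix.zero_mul]
      have := congrFun (congrFun this i) ⟨j + (n - k), by omega⟩
      rwa [mul_shift_apply_of_eq _ _ (j' := j) (by simp)] at this
    · intro i
      have hcol : ∀ i, (frame k z b x) i ⟨k - 1, by omega⟩ = x.1 i z := by
        intro i
        conv_rhs => rw [← hlift]
        simp only [frame, krylov, Matrix.of_apply]
        rw [show n - 1 - (k - 1) = n - k by omega]
        rfl
      have : (((g⁻¹ : Matrix.GeneralLinearGroup (Fin n) ℂ) : Matrix (Fin n) (Fin n) ℂ) *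
          frame k z b x) i ⟨k - 1, by omega⟩ = (act g⁻¹ x).1 i z := by
        simp only [act, Matrix.mul_apply, hcol]
      rw [← this, ← hg, Units.inv_mul, Matrix.one_apply]
      simp only [Fin.ext_iff]
      congr 1
      simp only [eq_iff_iff]
      omega
  obtain ⟨c, hc⟩ := hmem
  exact ⟨c, by rw [← hc, act_act_inv]⟩

theorem saturation_jordanSlice_subset :
    saturation (jordanSlice e) ⊆ component n p q k := by
  rintro _ ⟨g, c, rfl⟩
  exact ⟨g, _, jordanSlice_mem_unstable c, rfl⟩

/-- The functions whose nonvanishing defines the saturation of the slice. -/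
def sliceFun (k : ℕ) (z : Fin p) (a b d : Fin n) (x : W n p q) : ℂ :=
  (x.2.2 ^ (n - 1)) a b * (x.2.2 ^ (k - 1) * x.1) d z

theorem sliceFun_mem (a b d : Fin n) : sliceFun k z a b d ∈ polyFun (W n p q) :=
  mul_mem (matIn_snd_snd.pow _ a b) (((matIn_snd_snd.pow _).mul matIn_fst) d z)

theorem exists_sliceFun_ne_zero (hk : k ≤ n) (k1 : 1 ≤ k) {x : W n p q}
    (hx : x ∈ saturation (jordanSlice e)) : ∃ a b d, sliceFun k z a b d x ≠ 0 := by
  obtain ⟨g, c, rfl⟩ := hx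
  have hpow : ∀ a, (act g (jordanSlice e c)).2.2 ^ a = (g : Matrix (Fin n) (Fin n) ℂ) *
      shift n ℂ a *
      ((g⁻¹ : Matrix.GeneralLinearGroup (Fin n) ℂ) : Matrix (Fin n) (Fin n) ℂ) := by
    intro a
    rw [← shift_pow]
    exact Units.conj_pow g _ a
  have h1 : ∃ a b, ((act g (jordanSlice e c)).2.2 ^ (n - 1)) a b ≠ 0 := by
    by_contra hcon
    push Not at hcon
    have h0 : (act g (jordanSlice e c)).2.2 ^ (n - 1) = 0 := by ext a b; exact hcon a b
    rw [hpow] at h0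
    have h0' : shift n ℂ (n - 1) = 0 := by
      have := congrArg (fun A => ((g⁻¹ : Matrix.GeneralLinearGroup (Fin n) ℂ) :
        Matrix (Fin n) (Fin n) ℂ) * A * (g : Matrix (Fin n) (Fin n) ℂ)) h0
      simpa [Matrix.mul_assoc] using this
    have := congrFun (congrFun h0' ⟨0, by omega⟩) ⟨n - 1, by omega⟩
    simp [shift_apply] at this
  have h2 : ∃ d, ((act g (jordanSlice e c)).2.2 ^ (k - 1) *
      (act g (jordanSlice e c)).1) d z ≠ 0 := by
    by_contra hcon
    push Not at hcon
    have hcol : ∀ i, (shift n ℂ (k - 1) * (jordanSlice e c).1) i z = 0 := by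
      intro i
      have : shift n ℂ (k - 1) * (jordanSlice e c).1 =
          ((g⁻¹ : Matrix.GeneralLinearGroup (Fin n) ℂ) : Matrix (Fin n) (Fin n) ℂ) *
          ((act g (jordanSlice e c)).2.2 ^ (k - 1) * (act g (jordanSlice e c)).1) := by
        rw [hpow]
        simp [act, Matrix.mul_assoc]
      rw [this, Matrix.mul_apply]
      exact Finset.sum_eq_zero fun m _ => by rw [hcon, mul_zero]
    have := hcol ⟨0, by omega⟩
    rw [shift_mul_apply, dif_pos (by simp; omega)] at this
    simp [jordanSlice] at this
    omega
  obtain ⟨a, b, hab⟩ := h1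
  obtain ⟨d, hd⟩ := h2
  exact ⟨a, b, d, mul_ne_zero hab hd⟩

/-- Nonvanishing of both factors of `sliceFun` is exactly what makes the two Krylov matrices
invertible; this exhibits the saturation as open in C_k. -/
theorem mem_saturation_iff (hk : k ≤ n) (k1 : 1 ≤ k) {x : W n p q} :
    x ∈ saturation (jordanSlice e) ↔
      x ∈ component n p q k ∧ ∃ a b d, sliceFun k z a b d x ≠ 0 := by
  refine ⟨fun h => ⟨saturation_jordanSlice_subset h, exists_sliceFun_ne_zero hk k1 h⟩, ?_⟩
  rintro ⟨h, a, b, d, hne⟩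
  obtain ⟨h1, h2, h3⟩ := component_relations h
  obtain ⟨g, -, c, hc⟩ := frame_spec (e := e) hk k1 h1 h2 h3 (left_ne_zero_of_mul hne)
    (right_ne_zero_of_mul hne)
  exact ⟨g, c, hc⟩

theorem isZariskiOpenIn_saturation (hk : k ≤ n) (k1 : 1 ≤ k) :
    IsZariskiOpenIn (component n p q k) (saturation (jordanSlice e)) := by
  refine ⟨{f | ∃ a b d, f = sliceFun k z a b d}, ?_, ?_⟩
  · rintro _ ⟨a, b, d, rfl⟩
    exact sliceFun_mem a b d
  · ext x
    rw [mem_saturation_iff hk k1]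
    refine and_congr_right fun _ => ⟨?_, ?_⟩
    · rintro ⟨a, b, d, h⟩
      exact ⟨_, ⟨a, b, d, rfl⟩, h⟩
    · rintro ⟨_, ⟨a, b, d, rfl⟩, h⟩
      exact ⟨a, b, d, h⟩

theorem matIn_krylov {X β : Type*} {B : Subalgebra ℂ (X → ℂ)}
    {v : X → Matrix (Fin n) (Fin n) ℂ} {Y : X → Matrix (Fin n) β ℂ} (hv : MatIn B v)
    (hY : MatIn B Y) (b : β) : MatIn B fun x => krylov (v x) (Y x) b :=
  fun i _ => ((hv.pow _).mul hY) i b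

theorem isSlice_jordanSlice (hk : k ≤ n) (hkk : n - k ≤ k) (k1 : 1 ≤ k) :
    IsSlice (jordanSlice e) := by
  have hret : ∃ ρ : W n p q →ₗ[ℂ] (ι → ℂ), ∀ c, ρ (jordanSlice e c) = c := by
    refine ⟨⟨⟨fun w a => Sum.elim (fun x => w.1 x.1 x.2) (fun x => w.2.1 x.1 x.2) (e a), ?_⟩, ?_⟩,
      ?_⟩
    · intro w w'
      ext a
      rcases h : e a with x | x <;> simp [h]
    · intro r w
      ext a
      rcases h : e a with x | x <;> simp [h]
    · intro c
      ext a
      rcases h : e a with ⟨i, j⟩ | ⟨_, j⟩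
      · simp [h, jordanSlice, j.2, i.2, (Equiv.symm_apply_eq e).mpr h.symm]
      · simp [h, jordanSlice, j.2, (Equiv.symm_apply_eq e).mpr h.symm]
  have hstab : ∀ g c c', act g (jordanSlice e c) = jordanSlice e c' →
      ∀ c'', act g (jordanSlice e c'') = jordanSlice e c'' := fun g c c' h =>
    jordanSlice_stab hk hkk k1 h
  refine ⟨?_, hret, hstab, ?_, ?_⟩
  · have hcoord : ∀ a, (fun c : ι → ℂ => c a) ∈ polyFun (ι → ℂ) := fun a =>
      dual_mem_polyFun (LinearMap.proj (R := ℂ) (φ := fun _ : ι => ℂ) a)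
    refine dual_W_mem (F := jordanSlice e) (fun i j => ?_) (fun i j => ?_) (MatIn.const _)
    · simp only [jordanSlice, Matrix.of_apply]
      by_cases h : j = z
      · simp only [dif_pos h]
        exact (polyFun _).algebraMap_mem _
      · by_cases h' : (i : ℕ) < k
        · simp only [dif_neg h, dif_pos h']
          exact hcoord _
        · simp only [dif_neg h, dif_neg h']
          exact (polyFun _).zero_mem
    · simp only [jordanSlice, Matrix.of_apply]
      by_cases h : k ≤ (j : ℕ)
      · simp only [dif_pos h]
        exact hcoord _
      · simp only [dif_neg h]
        exact (polyFun _).zero_mem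
  · intro g c c' h
    obtain ⟨ρ, hρ⟩ := hret
    rw [← hρ c, ← hρ c', ← h, hstab g c c' h]
  · intro x₀ hx₀
    obtain ⟨a, b, d, hne⟩ := exists_sliceFun_ne_zero hk k1 hx₀
    refine ⟨frame k z b, ?_, sliceFun k z a b d, sliceFun_mem a b d, hne, fun x hx hQ => ?_⟩
    · have hle := polyFun_le_regAt (saturation (jordanSlice e)) x₀
      have hP : MatIn (regAt (saturation (jordanSlice e)) x₀) fun x : W n p q =>
          krylov x.2.2 (1 : Matrix (Fin n) (Fin n) ℂ) b :=
        matIn_krylov (matIn_snd_snd.mono hle) (MatIn.const _) b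
      have hdet : IsUnit (krylov x₀.2.2 (1 : Matrix (Fin n) (Fin n) ℂ) b).det := by
        rw [← Matrix.isUnit_iff_isUnit_det]
        refine isUnit_krylov (component_relations (saturation_jordanSlice_subset hx₀)).1
          (a := a) ?_
        rw [Matrix.mul_one]
        exact left_ne_zero_of_mul hne
      exact matIn_krylov (matIn_snd_snd.mono hle)
        (hP.mul ((MatIn.const _).mul ((hP.inv_regAt hx₀ hdet).mul (matIn_fst.mono hle)))) z
    · obtain ⟨h1, h2, h3⟩ := component_relations (saturation_jordanSlice_subset hx)
      exact frame_spec hk k1 h1 h2 h3 (left_ne_zero_of_mul hQ) (right_ne_zero_of_mul hQ)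

end JordanSlice

end EnhancedAdjoint

/-! ### Density of the saturation and nilpotency of the component -/

namespace EnhancedAdjoint

open Matrix

variable {n p q k : ℕ}

/-- A polynomial function restricted to a line is a polynomial. -/
theorem exists_polynomial_line {X : Type*} [AddCommGroup X] [Module ℂ X] {f : X → ℂ}
    (hf : f ∈ polyFun X) (x y : X) : ∃ P : Polynomial ℂ, ∀ t : ℂ, f (x + t • y) = P.eval t := by
  unfold polyFun at hf
  induction hf using Algebra.adjoin_induction with
  | mem f hf =>
    obtain ⟨l, rfl⟩ := hf
    exact ⟨Polynomial.C (l x) + Polynomial.C (l y) * Polynomial.X, fun t => by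
      simp only [map_add, map_smul, smul_eq_mul, mul_comm t, Polynomial.eval_add,
        Polynomial.eval_mul, Polynomial.eval_C, Polynomial.eval_X]⟩
  | algebraMap r => exact ⟨Polynomial.C r, fun t => by simp⟩
  | add f g _ _ hf hg =>
    obtain ⟨P, hP⟩ := hf
    obtain ⟨Q, hQ⟩ := hg
    exact ⟨P + Q, fun t => by simp [hP, hQ]⟩
  | mul f g _ _ hf hg =>
    obtain ⟨P, hP⟩ := hf
    obtain ⟨Q, hQ⟩ := hg
    exact ⟨P * Q, fun t => by simp [hP, hQ]⟩

theorem act_line (g : Matrix.GeneralLinearGroup (Fin n) ℂ) (x y : W n p q) (t : ℂ) :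
    act g (x + t • y) = act g x + t • act g y := by
  simp [act, Matrix.mul_add, Matrix.add_mul]

theorem unstable_line {x y : W n p q} (hx : x ∈ unstable n p q k) (hy : y ∈ unstable n p q k)
    (t : ℂ) : x + t • (y - x) ∈ unstable n p q k := by
  refine ⟨fun i j h => ?_, fun i j h => ?_, fun i j h => ?_⟩
  · simp [hx.1 i j h, hy.1 i j h]
  · simp [hx.2.1 i j h, hy.2.1 i j h]
  · simp [hx.2.2 i j h, hy.2.2 i j h]

/-- Join g · w, with w in the slice, to g · u by a line inside C_k. On it f times a slice function
vanishes identically, and the slice function is nonzero at g · w, so f vanishes along the line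
because ℂ[t] is a domain. -/
theorem component_subset_zariskiClosure {ι : Type*} {z : Fin p} {e : ι ≃ SliceIndex n p q k z}
    (hk : k ≤ n) (k1 : 1 ≤ k) :
    component n p q k ⊆ zariskiClosure (saturation (jordanSlice e)) := by
  rintro _ ⟨g, u, hu, rfl⟩ f hf hvan
  obtain ⟨a, b, d, hne⟩ := exists_sliceFun_ne_zero (e := e) hk k1 ⟨g, 0, rfl⟩
  set w := jordanSlice e 0 with hw
  obtain ⟨P, hP⟩ := exists_polynomial_line hf (act g w) (act g (u - w))
  obtain ⟨Q, hQ⟩ := exists_polynomial_line (sliceFun_mem (k := k) (z := z) a b d) (act g w)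
    (act g (u - w))
  have hPQ : P * Q = 0 := by
    refine Polynomial.funext fun t => ?_
    rw [Polynomial.eval_mul, ← hP, ← hQ, Polynomial.eval_zero, ← act_line]
    by_cases h : sliceFun k z a b d (act g (w + t • (u - w))) = 0
    · rw [h, mul_zero]
    · rw [hvan _ ((mem_saturation_iff hk k1).mpr ⟨⟨g, _, unstable_line
        (jordanSlice_mem_unstable 0) hu t, rfl⟩, a, b, d, h⟩), zero_mul]
  have hQ0 : Q ≠ 0 := by
    rintro rfl
    have := hQ 0
    rw [zero_smul, add_zero] at this
    exact hne (by simpa using this)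
  have hP0 := (mul_eq_zero.mp hPQ).resolve_right hQ0
  have := hP 1
  rwa [← act_line, one_smul, add_sub_cancel, hP0, Polynomial.eval_zero] at this

/-- The weights of a one-parameter subgroup contracting the unstable subspace. -/
def weight (k i : ℕ) : ℤ := if i < k then (k : ℤ) - i else (k : ℤ) - 1 - i

/-- The one-parameter subgroup with weights `weight k`. -/
noncomputable def oneParam (n k : ℕ) (t : ℂ) (ht : t ≠ 0) :
    Matrix.GeneralLinearGroup (Fin n) ℂ where
  val := Matrix.diagonal fun i : Fin n => t ^ weight k i
  inv := Matrix.diagonal fun i : Fin n => t ^ (-weight k i)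
  val_inv := by
    rw [Matrix.diagonal_mul_diagonal, ← Matrix.diagonal_one]
    congr 1
    ext i
    rw [← zpow_add₀ ht, add_neg_cancel, zpow_zero]
  inv_val := by
    rw [Matrix.diagonal_mul_diagonal, ← Matrix.diagonal_one]
    congr 1
    ext i
    rw [← zpow_add₀ ht, neg_add_cancel, zpow_zero]

theorem unstable_subset_nullCone {w : W n p q} (hw : w ∈ unstable n p q k) :
    w ∈ nullCone n p q := by
  intro f hf hvan
  obtain ⟨h1, h2, h3⟩ := hw
  -- The weights decrease strictly, positive before k and negative from k on, so every entry that
  -- can be nonzero on U_k is scaled by a positive power of t. The curve extends polynomially to 0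
  -- at t = 0; truncation by `toNat` affects only entries that vanish.
  set c : ℂ → W n p q := fun t =>
    (Matrix.of fun i j => t ^ (weight k i).toNat * w.1 i j,
      Matrix.of fun i j => t ^ (-weight k j).toNat * w.2.1 i j,
      Matrix.of fun i j => t ^ (weight k i - weight k j).toNat * w.2.2 i j) with hc
  have hpow : ∀ (N : ℕ) (r : ℂ), (fun t : ℂ => t ^ N * r) ∈ polyFun ℂ := fun N r =>
    mul_mem (pow_mem (dual_mem_polyFun (LinearMap.id : ℂ →ₗ[ℂ] ℂ)) N)
      ((polyFun ℂ).algebraMap_mem r)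
  have hcf : (fun t => f (c t)) ∈ polyFun ℂ :=
    polyFun_comp (dual_W_mem (F := c) (fun i j => hpow _ _) (fun i j => hpow _ _)
      fun i j => hpow _ _) hf
  have hc0 : c 0 = 0 := by
    refine Prod.ext ?_ (Prod.ext ?_ ?_)
    · ext i j
      by_cases hi : (i : ℕ) < k
      · have : (weight k i).toNat ≠ 0 := by
          rw [weight, if_pos hi]
          omega
        simp [hc, this]
      · simp [hc, h1 i j (not_lt.mp hi)]
    · ext i j
      by_cases hj : (j : ℕ) < k
      · simp [hc, h2 i j hj]
      · have : (-weight k j).toNat ≠ 0 := by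
          rw [weight, if_neg hj]
          omega
        simp [hc, this]
    · ext i j
      by_cases hij : j ≤ i
      · simp [hc, h3 i j hij]
      · have : (weight k i - weight k j).toNat ≠ 0 := by
          have := Fin.lt_def.mp (not_le.mp hij)
          unfold weight
          split_ifs <;> omega
        simp [hc, this]
  have hct : ∀ t (ht : t ≠ 0), c t = act (oneParam n k t ht) w := by
    intro t ht
    have hz : ∀ a : ℤ, 0 ≤ a → t ^ a.toNat = t ^ a := fun a ha => by
      rw [← zpow_natCast, Int.toNat_of_nonneg ha]
    refine Prod.ext ?_ (Prod.ext ?_ ?_)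
    · ext i j
      change _ = (Matrix.diagonal (fun i : Fin n => t ^ weight k i) * w.1) i j
      rw [Matrix.diagonal_mul]
      by_cases hi : (i : ℕ) < k
      · simp only [hc, Matrix.of_apply]
        rw [hz _ (by rw [weight, if_pos hi]; omega)]
      · simp [hc, h1 i j (not_lt.mp hi)]
    · ext i j
      change _ = (w.2.1 * Matrix.diagonal (fun i : Fin n => t ^ (-weight k i))) i j
      rw [Matrix.mul_diagonal]
      by_cases hj : (j : ℕ) < k
      · simp [hc, h2 i j hj]
      · simp only [hc, Matrix.of_apply]
        rw [hz _ (by rw [weight, if_neg hj]; omega), mul_comm]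
    · ext i j
      change _ = (Matrix.diagonal (fun i : Fin n => t ^ weight k i) * w.2.2 *
        Matrix.diagonal (fun i : Fin n => t ^ (-weight k i))) i j
      rw [Matrix.mul_diagonal, Matrix.diagonal_mul]
      by_cases hij : j ≤ i
      · simp [hc, h3 i j hij]
      · simp only [hc, Matrix.of_apply]
        rw [hz, sub_eq_add_neg, zpow_add₀ ht]
        · ring
        · have := Fin.lt_def.mp (not_le.mp hij)
          unfold weight
          split_ifs <;> omega
  obtain ⟨P, hP⟩ := exists_polynomial_line hcf 0 1
  simp only [zero_add, smul_eq_mul, mul_one] at hP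
  -- The polynomial vanishes for t ≠ 0, where the curve lies in the orbit; the factor X takes care
  -- of t = 0.
  have hXP : Polynomial.X * P = 0 := by
    refine Polynomial.funext fun t => ?_
    rw [Polynomial.eval_mul, Polynomial.eval_X, Polynomial.eval_zero]
    by_cases ht : t = 0
    · rw [ht, zero_mul]
    · rw [← hP, hct t ht, hvan _ ⟨_, rfl⟩, mul_zero]
  have hP0 := (mul_eq_zero.mp hXP).resolve_left Polynomial.X_ne_zero
  rw [← hc0, hP, hP0, Polynomial.eval_zero]

theorem component_subset_nullCone : component n p q k ⊆ nullCone n p q := by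
  rintro _ ⟨g, w, hw, rfl⟩
  rw [nullCone, Set.mem_ofPred_eq, orbit_act]
  exact unstable_subset_nullCone hw

end EnhancedAdjoint

/-! ### Orbit dimension inside the function field of GL_n -/

namespace EnhancedAdjoint

open Matrix

/-- The function field of `GL_n`. -/
abbrev GenField (n : ℕ) : Type := FractionRing (MvPolynomial (Fin n × Fin n) ℂ)

/-- The generic matrix. -/
noncomputable def gen (n : ℕ) : Matrix (Fin n) (Fin n) (GenField n) :=
  (mvPolynomialX (Fin n) (Fin n) ℂ).map (algebraMap _ (GenField n))

/-- Extension of scalars of a complex matrix. -/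
noncomputable abbrev baseChange {a b : Type*} (F : Type*) [Field F] [Algebra ℂ F] (A : Matrix a b ℂ) :
    Matrix a b F := A.map (algebraMap ℂ F)

/-- The indices of the entries of an element of `W`. -/
abbrev CoordIndex (n p q : ℕ) : Type := Fin n × Fin p ⊕ Fin q × Fin n ⊕ Fin n × Fin n

/-- The family of entries of a triple of matrices. -/
def coords {n p q : ℕ} {R : Type*} (B : Matrix (Fin n) (Fin p) R) (C : Matrix (Fin q) (Fin n) R)
    (A : Matrix (Fin n) (Fin n) R) : CoordIndex n p q → R :=
  Sum.elim (fun x => B x.1 x.2) (Sum.elim (fun x => C x.1 x.2) fun x => A x.1 x.2)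

section Generic

variable {n p q : ℕ}

theorem det_gen : (gen n).det =
    algebraMap _ (GenField n) (mvPolynomialX (Fin n) (Fin n) ℂ).det :=
  (RingHom.map_det (algebraMap _ (GenField n)) _).symm

theorem det_gen_ne_zero : (gen n).det ≠ 0 := by
  rw [det_gen, Ne, FaithfulSMul.algebraMap_eq_zero_iff]
  exact det_mvPolynomialX_ne_zero _ _

theorem isUnit_det_gen : IsUnit (gen n).det := det_gen_ne_zero.isUnit

/-- Evaluation of a polynomial in the matrix entries. -/
noncomputable def evalAt (g : Matrix (Fin n) (Fin n) ℂ) : MvPolynomial (Fin n × Fin n) ℂ →+* ℂ :=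
  MvPolynomial.eval fun x => g x.1 x.2

theorem map_evalAt (g : Matrix (Fin n) (Fin n) ℂ) :
    (mvPolynomialX (Fin n) (Fin n) ℂ).map (evalAt g) = g := by
  ext i j
  simp [evalAt]

theorem evalAt_det (g : Matrix (Fin n) (Fin n) ℂ) :
    evalAt g (mvPolynomialX (Fin n) (Fin n) ℂ).det = g.det := by
  rw [RingHom.map_det, RingHom.mapMatrix_apply, map_evalAt]

variable (n) in
/-- Pairs consisting of a regular function on `GL_n` and the corresponding element of the
function field. -/
noncomputable def regularPairs :
    Subalgebra ℂ ((Matrix.GeneralLinearGroup (Fin n) ℂ → ℂ) × GenField n) where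
  carrier := {x | ∃ (N : ℕ) (F : MvPolynomial (Fin n × Fin n) ℂ),
    x.2 * (gen n).det ^ N = algebraMap _ _ F ∧
    ∀ g : Matrix.GeneralLinearGroup (Fin n) ℂ,
      x.1 g * (g : Matrix (Fin n) (Fin n) ℂ).det ^ N = evalAt g F}
  mul_mem' := by
    rintro x y ⟨N, F, h1, h2⟩ ⟨N', F', h1', h2'⟩
    refine ⟨N + N', F * F', ?_, fun g => ?_⟩
    · rw [map_mul, ← h1, ← h1', pow_add, Prod.snd_mul]
      ring
    · rw [map_mul, ← h2, ← h2', pow_add, Prod.fst_mul, Pi.mul_apply]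
      ring
  add_mem' := by
    rintro x y ⟨N, F, h1, h2⟩ ⟨N', F', h1', h2'⟩
    refine ⟨N + N', F * (mvPolynomialX (Fin n) (Fin n) ℂ).det ^ N' +
      F' * (mvPolynomialX (Fin n) (Fin n) ℂ).det ^ N, ?_, fun g => ?_⟩
    · rw [map_add, map_mul, map_mul, map_pow, map_pow, ← h1, ← h1', pow_add, Prod.snd_add,
        ← det_gen]
      ring
    · rw [map_add, map_mul, map_mul, map_pow, map_pow, ← h2, ← h2', pow_add, Prod.fst_add,
        evalAt_det, Pi.add_apply]
      ring
  algebraMap_mem' r := by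
    refine ⟨0, MvPolynomial.C r, ?_, fun g => ?_⟩
    · rw [pow_zero, mul_one]
      exact IsScalarTower.algebraMap_apply ℂ (MvPolynomial (Fin n × Fin n) ℂ) (GenField n) r
    · simp [evalAt]

/-- Density of GL_n in all matrices: a numerator vanishing on GL_n becomes identically zero after
multiplication by the determinant. -/
theorem fst_eq_zero_iff {x : (Matrix.GeneralLinearGroup (Fin n) ℂ → ℂ) × GenField n}
    (hx : x ∈ regularPairs n) : x.1 = 0 ↔ x.2 = 0 := by
  obtain ⟨N, F, h1, h2⟩ := hx
  constructor
  · intro h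
    have hF : F * (mvPolynomialX (Fin n) (Fin n) ℂ).det = 0 := by
      refine MvPolynomial.funext fun y => ?_
      have hy : MvPolynomial.eval y = evalAt (Matrix.of fun i j => y (i, j)) := rfl
      rw [hy, map_mul, map_zero, evalAt_det]
      by_cases hd : (Matrix.of fun i j => y (i, j)).det = 0
      · rw [hd, mul_zero]
      · have := h2 (Matrix.GeneralLinearGroup.mkOfDetNeZero _ hd)
        rw [h, Pi.zero_apply, zero_mul] at this
        exact mul_eq_zero_of_left this.symm _
    have hF0 := (mul_eq_zero.mp hF).resolve_right (det_mvPolynomialX_ne_zero _ _)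
    rw [hF0, map_zero] at h1
    exact (mul_eq_zero.mp h1).resolve_right (pow_ne_zero _ det_gen_ne_zero)
  · intro h
    rw [h, zero_mul, eq_comm, FaithfulSMul.algebraMap_eq_zero_iff] at h1
    ext g
    have := h2 g
    rw [h1, map_zero] at this
    refine (mul_eq_zero.mp this).resolve_right (pow_ne_zero _ ?_)
    exact ((Matrix.isUnit_iff_isUnit_det _).mp g.isUnit).ne_zero

/-- Corresponding entries are corresponding regular functions. -/
def PairIn {a b : Type*} (A : Matrix.GeneralLinearGroup (Fin n) ℂ → Matrix a b ℂ)
    (A' : Matrix a b (GenField n)) : Prop :=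
  ∀ i j, ((fun g => A g i j, A' i j) :
    (Matrix.GeneralLinearGroup (Fin n) ℂ → ℂ) × GenField n) ∈ regularPairs n

theorem PairIn.mul {a b c : Type*} [Fintype b]
    {A : Matrix.GeneralLinearGroup (Fin n) ℂ → Matrix a b ℂ} {A' : Matrix a b (GenField n)}
    {B : Matrix.GeneralLinearGroup (Fin n) ℂ → Matrix b c ℂ} {B' : Matrix b c (GenField n)}
    (hA : PairIn A A') (hB : PairIn B B') : PairIn (fun g => A g * B g) (A' * B') := by
  intro i j
  have : ((fun g => (A g * B g) i j, (A' * B') i j) :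
      (Matrix.GeneralLinearGroup (Fin n) ℂ → ℂ) × GenField n) =
      ∑ m, (fun g => A g i m, A' i m) * (fun g => B g m j, B' m j) := by
    refine Prod.ext ?_ ?_
    · ext g
      simp [Matrix.mul_apply, Prod.fst_sum]
    · simp [Matrix.mul_apply, Prod.snd_sum]
  rw [this]
  exact sum_mem fun m _ => mul_mem (hA i m) (hB m j)

theorem pairIn_const {a b : Type*} (A : Matrix a b ℂ) :
    PairIn (n := n) (fun _ => A) (baseChange (GenField n) A) := fun i j =>
  (regularPairs n).algebraMap_mem (A i j)

theorem pairIn_gen : PairIn (n := n) (fun g => (g : Matrix (Fin n) (Fin n) ℂ)) (gen n) := by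
  intro i j
  refine ⟨0, MvPolynomial.X (i, j), ?_, fun g => ?_⟩
  · simp [gen]
  · simp [evalAt]

theorem pairIn_gen_inv : PairIn (n := n)
    (fun g => ((g⁻¹ : Matrix.GeneralLinearGroup (Fin n) ℂ) : Matrix (Fin n) (Fin n) ℂ))
    (gen n)⁻¹ := by
  intro i j
  have hadj : ∀ {S : Type} [CommRing S] (f : MvPolynomial (Fin n × Fin n) ℂ →+* S),
      ((mvPolynomialX (Fin n) (Fin n) ℂ).map f).adjugate i j =
        f ((mvPolynomialX (Fin n) (Fin n) ℂ).adjugate i j) := fun f =>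
    congrFun (congrFun (RingHom.map_adjugate f (mvPolynomialX (Fin n) (Fin n) ℂ)).symm i) j
  refine ⟨1, (mvPolynomialX (Fin n) (Fin n) ℂ).adjugate i j, ?_, fun g => ?_⟩
  · rw [← hadj, pow_one, Matrix.inv_def, Ring.inverse_eq_inv', Matrix.smul_apply, smul_eq_mul,
      mul_right_comm, inv_mul_cancel₀ det_gen_ne_zero, one_mul]
    rfl
  · have hd : (g : Matrix (Fin n) (Fin n) ℂ).det ≠ 0 :=
      ((Matrix.isUnit_iff_isUnit_det _).mp g.isUnit).ne_zero
    change ((g⁻¹ : Matrix.GeneralLinearGroup (Fin n) ℂ) : Matrix (Fin n) (Fin n) ℂ) i j * _ = _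
    rw [← hadj, map_evalAt, pow_one, Matrix.coe_units_inv, Matrix.inv_def, Ring.inverse_eq_inv',
      Matrix.smul_apply, smul_eq_mul, mul_right_comm, inv_mul_cancel₀ hd, one_mul]

/-- The entries of the generic point of the orbit of `w`. -/
noncomputable def genCoords (w : W n p q) : CoordIndex n p q → GenField n :=
  coords (gen n * baseChange _ w.1) (baseChange _ w.2.1 * (gen n)⁻¹) (gen n * baseChange _ w.2.2 * (gen n)⁻¹)

/-- The coordinate ring of the orbit of `w` as a subring of the function field of `GL_n`. -/
noncomputable def orbitRing (w : W n p q) : Subalgebra ℂ (GenField n) :=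
  Algebra.adjoin ℂ (Set.range (genCoords w))

/-- The entries of the orbit map. -/
noncomputable def orbitCoords (w : W n p q) :
    CoordIndex n p q → Matrix.GeneralLinearGroup (Fin n) ℂ → ℂ :=
  fun a g => coords (act g w).1 (act g w).2.1 (act g w).2.2 a

theorem pair_mem (w : W n p q) (a : CoordIndex n p q) :
    (orbitCoords w a, genCoords w a) ∈ regularPairs n := by
  rcases a with ⟨i, j⟩ | ⟨i, j⟩ | ⟨i, j⟩
  · exact (pairIn_gen.mul (pairIn_const w.1)) i j
  · exact ((pairIn_const w.2.1).mul pairIn_gen_inv) i j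
  · exact ((pairIn_gen.mul (pairIn_const w.2.2)).mul pairIn_gen_inv) i j

/-- Pulling back functions along the orbit map. -/
def orbitPullback (w : W n p q) :
    (orbit w → ℂ) →ₐ[ℂ] (Matrix.GeneralLinearGroup (Fin n) ℂ → ℂ) where
  toFun f g := f ⟨act g w, g, rfl⟩
  map_one' := rfl
  map_mul' _ _ := rfl
  map_zero' := rfl
  map_add' _ _ := rfl
  commutes' _ := rfl

theorem map_orbitPullback (w : W n p q) : (coordRing (orbit w)).map (orbitPullback w) =
    Algebra.adjoin ℂ (Set.range (orbitCoords w)) := by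
  rw [coordRing, AlgHom.map_adjoin]
  apply le_antisymm
  · refine Algebra.adjoin_le ?_
    rintro _ ⟨_, ⟨l, rfl⟩, rfl⟩
    have hmem : ∀ a, orbitCoords w a ∈ Algebra.adjoin ℂ (Set.range (orbitCoords w)) := fun a =>
      Algebra.subset_adjoin ⟨a, rfl⟩
    exact dual_W_mem (F := fun g => act g w) (fun i j => hmem (Sum.inl (i, j)))
      (fun i j => hmem (Sum.inr (Sum.inl (i, j)))) (fun i j => hmem (Sum.inr (Sum.inr (i, j)))) l
  · refine Algebra.adjoin_mono ?_
    rintro _ ⟨a, rfl⟩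
    rcases a with ⟨i, j⟩ | ⟨i, j⟩ | ⟨i, j⟩
    · exact ⟨_, ⟨⟨⟨fun w => w.1 i j, fun _ _ => rfl⟩, fun _ _ => rfl⟩, rfl⟩, rfl⟩
    · exact ⟨_, ⟨⟨⟨fun w => w.2.1 i j, fun _ _ => rfl⟩, fun _ _ => rfl⟩, rfl⟩, rfl⟩
    · exact ⟨_, ⟨⟨⟨fun w => w.2.2 i j, fun _ _ => rfl⟩, fun _ _ => rfl⟩, rfl⟩, rfl⟩

theorem trdeg_map_eq {A B : Type} [CommRing A] [CommRing B] [Algebra ℂ A] [Algebra ℂ B]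
    (S : Subalgebra ℂ A) (f : A →ₐ[ℂ] B) (hf : ∀ x ∈ S, f x = 0 → x = 0) :
    Algebra.trdeg ℂ S = Algebra.trdeg ℂ (S.map f) := by
  have hinj : Function.Injective (f.comp S.val) :=
    (injective_iff_map_eq_zero _).mpr fun x hx => Subtype.ext (hf x x.2 hx)
  have e := (AlgEquiv.ofInjective _ hinj).trdeg_eq
  rwa [AlgHom.range_comp, Subalgebra.range_val] at e

/-- The algebra generated by the pairs of corresponding coordinates projects injectively to both
factors, by `fst_eq_zero_iff`. One image is the coordinate ring pulled back to GL_n, the other is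
`orbitRing w`. -/
theorem varDim_orbit_eq (w : W n p q) : varDim (orbit w) = Algebra.trdeg ℂ (orbitRing w) := by
  set S : Subalgebra ℂ ((Matrix.GeneralLinearGroup (Fin n) ℂ → ℂ) × GenField n) :=
    Algebra.adjoin ℂ (Set.range fun a => (orbitCoords w a, genCoords w a)) with hS
  have hle : S ≤ regularPairs n := by
    refine Algebra.adjoin_le ?_
    rintro _ ⟨a, rfl⟩
    exact pair_mem w a
  have h1 : S.map (AlgHom.fst ℂ _ _) = Algebra.adjoin ℂ (Set.range (orbitCoords w)) := by
    rw [hS, AlgHom.map_adjoin, ← Set.range_comp]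
    rfl
  have h2 : S.map (AlgHom.snd ℂ _ _) = orbitRing w := by
    rw [hS, AlgHom.map_adjoin, ← Set.range_comp]
    rfl
  rw [varDim, trdeg_map_eq (coordRing (orbit w)) (orbitPullback w), map_orbitPullback, ← h1,
    ← trdeg_map_eq S (AlgHom.fst ℂ _ _), trdeg_map_eq S (AlgHom.snd ℂ _ _), h2]
  · exact fun x hx h => Prod.ext ((fst_eq_zero_iff (hle hx)).mpr h) h
  · exact fun x hx h => Prod.ext h ((fst_eq_zero_iff (hle hx)).mp h)
  · intro f _ hf
    ext ⟨_, g, rfl⟩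
    exact congrFun hf g

theorem trdeg_genField : Algebra.trdeg ℂ (GenField n) = ((n ^ 2 : ℕ) : Cardinal) := by
  have : Algebra.IsAlgebraic (MvPolynomial (Fin n × Fin n) ℂ) (GenField n) :=
    IsLocalization.isAlgebraic _ (nonZeroDivisors (MvPolynomial (Fin n × Fin n) ℂ))
  rw [← trdeg_add_eq ℂ (MvPolynomial (Fin n × Fin n) ℂ) (A := GenField n),
    MvPolynomial.trdeg_of_isDomain,
    trdeg_eq_zero (R := MvPolynomial (Fin n × Fin n) ℂ) (A := GenField n)]
  simp [sq]

/-- The dimension of an orbit and the transcendence degree of the function field of `GL_n` over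
that of the orbit add up to `n²`. -/
theorem varDim_orbit_add (w : W n p q) :
    varDim (orbit w) + Algebra.trdeg (orbitRing w) (GenField n) = ((n ^ 2 : ℕ) : Cardinal) := by
  have : FaithfulSMul ℂ (orbitRing w) := (faithfulSMul_iff_algebraMap_injective _ _).mpr
    (algebraMap ℂ (orbitRing w)).injective
  have : FaithfulSMul (orbitRing w) (GenField n) := (faithfulSMul_iff_algebraMap_injective _ _).mpr
    Subtype.val_injective
  rw [varDim_orbit_eq, trdeg_add_eq, trdeg_genField]

end Generic

end EnhancedAdjoint

/-! ### Orbits of slice points are large -/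

namespace EnhancedAdjoint

open Matrix

section Subfields

/-- The subfield of elements algebraic over a domain. -/
def algSubfield (R K : Type*) [CommRing R] [IsDomain R] [Field K] [Algebra R K] : Subfield K :=
  { Subalgebra.algebraicClosure R K with
    neg_mem' := fun hx => (Subalgebra.algebraicClosure R K).neg_mem hx
    inv_mem' := fun _ hx => IsAlgebraic.inv hx }

theorem mem_algSubfield {R K : Type*} [CommRing R] [IsDomain R] [Field K] [Algebra R K] {x : K} :
    x ∈ algSubfield R K ↔ IsAlgebraic R x := Iff.rfl

theorem mem_subfield_of_fractionRing {F σ : Type*} [Field F]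
    (E : Subfield (FractionRing (MvPolynomial σ F)))
    (hC : ∀ c : F, algebraMap (MvPolynomial σ F) _ (MvPolynomial.C c) ∈ E)
    (hX : ∀ i : σ, algebraMap (MvPolynomial σ F) _ (MvPolynomial.X i) ∈ E)
    (x : FractionRing (MvPolynomial σ F)) : x ∈ E := by
  have hpoly : ∀ P : MvPolynomial σ F, algebraMap (MvPolynomial σ F) _ P ∈ E := by
    intro P
    induction P using MvPolynomial.induction_on with
    | C c => exact hC c
    | add P Q hP hQ => rw [map_add]; exact add_mem hP hQ
    | mul_X P i hP => rw [map_mul]; exact mul_mem hP (hX i)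
  obtain ⟨a, b, -, rfl⟩ := IsFractionRing.div_surjective (MvPolynomial σ F) x
  exact div_mem (hpoly a) (hpoly b)

/-- All entries of a matrix lie in a subfield. -/
def EntriesIn {K : Type*} [Field K] (E : Subfield K) {a b : Type*} (A : Matrix a b K) : Prop :=
  ∀ i j, A i j ∈ E

theorem EntriesIn.mul {K : Type*} [Field K] {E : Subfield K} {a b c : Type*} [Fintype b]
    {A : Matrix a b K} {B : Matrix b c K} (hA : EntriesIn E A) (hB : EntriesIn E B) :
    EntriesIn E (A * B) := fun i j => by
  rw [Matrix.mul_apply]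
  exact sum_mem fun m _ => mul_mem (hA i m) (hB m j)

theorem EntriesIn.pow {K : Type*} [Field K] {E : Subfield K} {a : Type*} [Fintype a]
    [DecidableEq a] {A : Matrix a a K} (hA : EntriesIn E A) (N : ℕ) : EntriesIn E (A ^ N) := by
  induction N with
  | zero =>
    intro i j
    rw [pow_zero, Matrix.one_apply]
    split_ifs
    · exact one_mem E
    · exact zero_mem E
  | succ N ih => rw [pow_succ]; exact ih.mul hA

/-- The unique solution of a linear system over a subfield has coordinates in the subfield. -/
theorem mem_of_mulVec_mem {K : Type*} [Field K] {E : Subfield K} {a b : Type*} [Fintype a]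
    [Fintype b] {N : Matrix a b K} (hN : EntriesIn E N)
    (hinj : ∀ u, N *ᵥ u = 0 → u = 0) {y : b → K} (hy : ∀ i, (N *ᵥ y) i ∈ E) (j : b) :
    y j ∈ E := by
  classical
  set N₀ : Matrix a b E := Matrix.of fun i j => ⟨N i j, hN i j⟩ with hN₀
  have hmap : N₀.map E.subtype = N := rfl
  -- An injective matrix has a left inverse over the subfield E itself, and this left inverse
  -- recovers y from N y.
  obtain ⟨g, hg⟩ := LinearMap.exists_leftInverse_of_injective (Matrix.toLin' N₀) (by
    rw [LinearMap.ker_eq_bot']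
    intro u hu
    have h0 : N *ᵥ (E.subtype ∘ u) = 0 := by
      rw [← hmap]
      ext i
      rw [← RingHom.map_mulVec]
      have : (N₀ *ᵥ u) i = 0 := congrFun hu i
      rw [this, map_zero]
      rfl
    ext j
    exact congrFun (hinj _ h0) j)
  have hmat : LinearMap.toMatrix' g * N₀ = 1 := by
    rw [← LinearMap.toMatrix'_toLin' N₀, ← LinearMap.toMatrix'_comp, hg,
      LinearMap.toMatrix'_id]
  have hmat' : (LinearMap.toMatrix' g).map E.subtype * N = 1 := by
    rw [← hmap, ← Matrix.map_mul, hmat, Matrix.map_one _ (map_zero _) (map_one _)]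
  have : y = (LinearMap.toMatrix' g).map E.subtype *ᵥ (N *ᵥ y) := by
    rw [Matrix.mulVec_mulVec, hmat', Matrix.one_mulVec]
  rw [this, Matrix.mulVec, dotProduct]
  exact sum_mem fun i _ => mul_mem (Subtype.prop _) (hy i)

end Subfields

section LowerBound

variable {n p q k : ℕ} {z : Fin p}

theorem genCoords_mem_orbitRing (w : W n p q) (a : CoordIndex n p q) :
    genCoords w a ∈ orbitRing w := Algebra.subset_adjoin ⟨a, rfl⟩

/-- Specializing the generic matrix to the identity turns this minor into 1. -/
theorem det_submatrix_gen_ne_zero {l : ℕ} (hl : l ≤ n) :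
    ((gen n).submatrix (Fin.castLE hl) (Fin.castLE hl)).det ≠ 0 := by
  have h : ((gen n).submatrix (Fin.castLE hl) (Fin.castLE hl)) =
      ((mvPolynomialX (Fin n) (Fin n) ℂ).submatrix (Fin.castLE hl) (Fin.castLE hl)).map
        (algebraMap _ (GenField n)) := rfl
  rw [h, ← RingHom.mapMatrix_apply, ← RingHom.map_det, Ne, FaithfulSMul.algebraMap_eq_zero_iff]
  intro h0
  have h1 := congrArg (evalAt (1 : Matrix (Fin n) (Fin n) ℂ)) h0
  rw [RingHom.map_det, RingHom.mapMatrix_apply, ← Matrix.submatrix_map, map_evalAt, map_zero,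
    Matrix.submatrix_one _ (Fin.castLE_injective hl), Matrix.det_one] at h1
  exact one_ne_zero h1

/-- For the generic g, the orbit ring contains the entries of M = g J g⁻¹ and of column k - 1 of g
(counted from 0). The last column y solves M^(n-k) y = (column k - 1), which determines it up to an
(n-k)-dimensional kernel; adjoining its first n - k entries pins it down. Every other column is a
power of M applied to y, so all of K becomes algebraic. -/
theorem trdeg_orbitRing_le (hk : k ≤ n) (hkk : n - k ≤ k) (k1 : 1 ≤ k) {w : W n p q}
    (hv : w.2.2 = shift n ℂ 1) (hξ : ∀ i, w.1 i z = if (i : ℕ) + 1 = k then 1 else 0) :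
    Algebra.trdeg (orbitRing w) (GenField n) ≤ ((n - k : ℕ) : Cardinal) := by
  set last : Fin n := ⟨n - 1, by omega⟩
  set ζ : Fin (n - k) → GenField n := fun i => gen n (Fin.castLE (by omega) i) last with hζ
  set S := Algebra.adjoin (orbitRing w) (Set.range ζ) with hS
  set E := algSubfield S (GenField n) with hE
  have hSE : ∀ x ∈ S, x ∈ E := fun x hx => isAlgebraic_algebraMap (⟨x, hx⟩ : S)
  have hRE : ∀ x ∈ orbitRing w, x ∈ E := fun x hx =>
    hSE x (S.algebraMap_mem (⟨x, hx⟩ : orbitRing w))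
  have hζE : ∀ i, ζ i ∈ E := fun i => hSE _ (Algebra.subset_adjoin ⟨i, rfl⟩)
  set M := gen n * baseChange (GenField n) w.2.2 * (gen n)⁻¹ with hM
  have hME : EntriesIn E M := fun i j =>
    hRE _ (genCoords_mem_orbitRing w (Sum.inr (Sum.inr (i, j))))
  have hshift : baseChange (GenField n) w.2.2 = shift n (GenField n) 1 := by
    ext i j
    rw [hv]
    simp only [baseChange, Matrix.map_apply, shift_apply]
    split_ifs <;> simp
  have hcomm : M * gen n = gen n * shift n (GenField n) 1 := by
    rw [hM, hshift, Matrix.nonsing_inv_mul_cancel_right _ _ isUnit_det_gen]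
  have hpow := pow_mul_eq_mul_shift hcomm
  have hcol : ∀ i, gen n i ⟨k - 1, by omega⟩ ∈ E := by
    intro i
    have := hRE _ (genCoords_mem_orbitRing w (Sum.inl (i, z)))
    have heq : genCoords w (Sum.inl (i, z)) = gen n i ⟨k - 1, by omega⟩ := by
      change (gen n * baseChange (GenField n) w.1) i z = _
      rw [Matrix.mul_apply, Finset.sum_eq_single (⟨k - 1, by omega⟩ : Fin n)]
      · simp only [baseChange, Matrix.map_apply, hξ]
        rw [if_pos (show k - 1 + 1 = k by omega), map_one, mul_one]
      · intro b _ hb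
        simp only [baseChange, Matrix.map_apply, hξ]
        rw [if_neg, map_zero, mul_zero]
        intro h
        exact hb (Fin.ext (by simp; omega))
      · simp
    rwa [heq] at this
  -- The linear system for the last column: M^(n-k) stacked on the projection to the first n - k
  -- coordinates. The kernel of M^(n-k) is spanned by the first n - k columns of g, and the leading
  -- minor makes the projection injective there.
  set N : Matrix (Fin n ⊕ Fin (n - k)) (Fin n) (GenField n) := Matrix.fromRows (M ^ (n - k))
    ((1 : Matrix (Fin n) (Fin n) (GenField n)).submatrix (Fin.castLE (by omega)) id) with hN
  have hNE : EntriesIn E N := by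
    rintro (i | i) j
    · exact hME.pow _ i j
    · simp only [hN, Matrix.fromRows_apply_inr, Matrix.submatrix_apply, Matrix.one_apply]
      split_ifs
      · exact one_mem E
      · exact zero_mem E
  have hlast : ∀ i, gen n i last ∈ E := by
    refine mem_of_mulVec_mem (y := fun i => gen n i last) hNE ?_ ?_
    · intro u hu
      have hu1 : M ^ (n - k) *ᵥ u = 0 := by
        ext i
        exact congrFun hu (Sum.inl i)
      have hu2 : ∀ i : Fin (n - k), u (Fin.castLE (by omega) i) = 0 := by
        intro i
        have := congrFun hu (Sum.inr i)
        simpa [hN, Matrix.fromRows_mulVec, Matrix.mulVec, dotProduct, Matrix.one_apply] using this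
      set u' := (gen n)⁻¹ *ᵥ u with hu'
      have huu' : u = gen n *ᵥ u' := by
        rw [hu', Matrix.mulVec_mulVec, Matrix.mul_nonsing_inv _ isUnit_det_gen,
          Matrix.one_mulVec]
      have hs : shift n (GenField n) (n - k) *ᵥ u' = 0 := by
        rw [huu', Matrix.mulVec_mulVec, hpow, ← Matrix.mulVec_mulVec] at hu1
        have := congrArg (fun x => (gen n)⁻¹ *ᵥ x) hu1
        simpa [Matrix.mulVec_mulVec, ← Matrix.mul_assoc,
          Matrix.nonsing_inv_mul _ isUnit_det_gen] using this
      have hbig : ∀ i : Fin n, n - k ≤ (i : ℕ) → u' i = 0 := by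
        intro i hi
        have h := congrFun hs ⟨i - (n - k), by omega⟩
        have h' := shift_mul_apply_of_eq (n := n) (a := n - k)
          (Matrix.of fun i (_ : Unit) => u' i) (i := ⟨i - (n - k), by omega⟩) (i' := i)
          (by simp; omega) ()
        rw [Matrix.mul_apply] at h'
        exact h'.symm.trans h
      have hsmall : (fun i : Fin (n - k) => u' (Fin.castLE (by omega) i)) = 0 := by
        refine Matrix.eq_zero_of_mulVec_eq_zero
          (det_submatrix_gen_ne_zero (n := n) (l := n - k) (by omega)) ?_
        ext i
        have h := hu2 i
        rw [huu'] at h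
        rw [Pi.zero_apply, ← h]
        simp only [Matrix.mulVec, dotProduct, Matrix.submatrix_apply]
        refine Finset.sum_of_injOn (Fin.castLE (by omega)) (Fin.castLE_injective _).injOn
          (fun _ _ => Finset.mem_coe.mpr (Finset.mem_univ _)) ?_ fun _ _ => rfl
        intro j _ hj
        rw [hbig j, mul_zero]
        by_contra hlt
        exact hj ⟨⟨j, by omega⟩, Finset.mem_coe.mpr (Finset.mem_univ _), rfl⟩
      rw [huu']
      have : u' = 0 := by
        ext i
        by_cases hi : (i : ℕ) < n - k
        · exact congrFun hsmall ⟨i, hi⟩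
        · exact hbig i (not_lt.mp hi)
      rw [this, Matrix.mulVec_zero]
    · rintro (i | i)
      · have : (N *ᵥ fun i => gen n i last) (Sum.inl i) = (M ^ (n - k) * gen n) i last := by
          simp [hN, Matrix.mulVec, dotProduct, Matrix.mul_apply]
        rw [this, hpow, mul_shift_apply_of_eq _ _ (j' := ⟨k - 1, by omega⟩) (by simp [last]; omega)]
        exact hcol i
      · have : (N *ᵥ fun i => gen n i last) (Sum.inr i) = ζ i := by
          simp [hN, hζ, Matrix.mulVec, dotProduct, Matrix.one_apply]
        rw [this]
        exact hζE i
  have hgen : EntriesIn E (gen n) := by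
    intro i j
    have h := mul_shift_apply_of_eq (gen n) i (j := last) (j' := j) (a := n - 1 - j)
      (by simp [last]; omega)
    rw [← hpow, Matrix.mul_apply] at h
    rw [← h]
    exact sum_mem fun m _ => mul_mem (hME.pow _ i m) (hlast m)
  have : Algebra.IsAlgebraic S (GenField n) := by
    refine ⟨fun x => mem_algSubfield.mp (mem_subfield_of_fractionRing E ?_ ?_ x)⟩
    · intro c
      exact hRE _ ((orbitRing w).algebraMap_mem c)
    · rintro ⟨i, j⟩
      exact hgen i j
  refine (Algebra.IsAlgebraic.trdeg_le_cardinalMk (orbitRing w) (Set.range ζ)).trans ?_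
  refine Cardinal.mk_range_le.trans ?_
  simp

end LowerBound

end EnhancedAdjoint

namespace EnhancedAdjoint

open Matrix

variable {n p q k : ℕ}

/-! ### Infinitesimal stabilizers on the unstable subspace -/

section Centralizer

/-- The matrices vanishing below the `c`-th superdiagonal. -/
def upperSubmodule (n c : ℕ) : Submodule ℂ (Matrix (Fin n) (Fin n) ℂ) where
  carrier := {A | IsUpper c A}
  add_mem' := fun hA hB i j h => by rw [Matrix.add_apply, hA i j h, hB i j h, add_zero]
  zero_mem' := fun _ _ _ => rfl
  smul_mem' := fun r A hA i j h => by rw [Matrix.smul_apply, hA i j h, smul_zero]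

/-- Rank–nullity twice: the rank of T is at most dim ker δ = dim V - m, so ker T has dimension at
least m. -/
theorem exists_linearIndependent_of_range_le_ker {V : Type*} [AddCommGroup V] [Module ℂ V]
    [FiniteDimensional ℂ V] {m : ℕ} (T : V →ₗ[ℂ] V) (δ : V →ₗ[ℂ] (Fin m → ℂ))
    (hδ : Function.Surjective δ) (hle : ∀ A, δ (T A) = 0) :
    ∃ X : Fin m → V, LinearIndependent ℂ X ∧ ∀ a, T (X a) = 0 := by
  have h1 := LinearMap.finrank_range_add_finrank_ker T
  have h2 := LinearMap.finrank_range_add_finrank_ker δ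
  have h3 : Module.finrank ℂ (LinearMap.range T) ≤ Module.finrank ℂ (LinearMap.ker δ) := by
    refine Submodule.finrank_mono ?_
    rintro _ ⟨A, rfl⟩
    exact LinearMap.mem_ker.mpr (hle A)
  rw [LinearMap.range_eq_top.mpr hδ, finrank_top, Module.finrank_fin_fun] at h2
  obtain ⟨X, hX⟩ := exists_linearIndependent_of_le_finrank
    (show m ≤ Module.finrank ℂ (LinearMap.ker T) by omega)
  exact ⟨fun a => (X a).1, hX.map' (LinearMap.ker T).subtype (Submodule.ker_subtype _),
    fun a => LinearMap.mem_ker.mp (X a).2⟩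

/-- The commutator with a strictly upper triangular matrix. -/
def commutator {v : Matrix (Fin n) (Fin n) ℂ} (hv : IsUpper 1 v) (c : ℕ) :
    upperSubmodule n c →ₗ[ℂ] upperSubmodule n c where
  toFun A := ⟨v * A.1 - A.1 * v, fun i j h => by
    rw [Matrix.sub_apply, (hv.mul A.2) i j (by omega), (A.2.mul hv) i j (by omega), sub_zero]⟩
  map_add' A B := Subtype.ext (by simp [Matrix.mul_add, Matrix.add_mul]; abel)
  map_smul' r A := Subtype.ext (by simp [smul_sub])

/-- The entries on the `c`-th superdiagonal. -/
def superdiagonal (n c : ℕ) : upperSubmodule n c →ₗ[ℂ] (Fin (n - c) → ℂ) where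
  toFun A i := A.1 ⟨i, by omega⟩ ⟨i + c, by omega⟩
  map_add' _ _ := rfl
  map_smul' _ _ := rfl

/-- A strictly upper triangular matrix commutes with an `n - c`-dimensional space of matrices
vanishing below the `c`-th superdiagonal. -/
theorem exists_linearIndependent_commute {c : ℕ} {v : Matrix (Fin n) (Fin n) ℂ}
    (hv : IsUpper 1 v) : ∃ X : Fin (n - c) → Matrix (Fin n) (Fin n) ℂ,
      LinearIndependent ℂ X ∧ ∀ a, IsUpper c (X a) ∧ v * X a = X a * v := by
  have hsurj : Function.Surjective (superdiagonal n c) := fun u =>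
    ⟨⟨Matrix.of fun i j => if h : (j : ℕ) = i + c then u ⟨i, by omega⟩ else 0, fun i j h => by
      rw [Matrix.of_apply, dif_neg (by omega)]⟩, funext fun i => dif_pos rfl⟩
  -- Commuting with a strictly upper triangular matrix raises the superdiagonal level from c to c +
  -- 1.
  have hle : ∀ A, superdiagonal n c (commutator hv c A) = 0 := fun A => by
    ext i
    change (v * A.1 - A.1 * v) _ _ = 0
    rw [Matrix.sub_apply, (hv.mul A.2) _ _ (by simp), (A.2.mul hv) _ _ (by simp),
      sub_zero]
  obtain ⟨X, hX, hX'⟩ := exists_linearIndependent_of_range_le_ker _ _ hsurj hle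
  exact ⟨fun a => (X a).1, hX.map' (upperSubmodule n c).subtype (Submodule.ker_subtype _),
    fun a => ⟨(X a).2, sub_eq_zero.mp (congrArg Subtype.val (hX' a))⟩⟩

/-- The infinitesimal stabilizer of every element of the unstable subspace contains a large
space of matrices. -/
theorem exists_linearIndependent_stabilizer (hk : k ≤ n) {w : W n p q}
    (hw : w ∈ unstable n p q k) :
    ∃ X : Fin (n - max k (n - k)) → Matrix (Fin n) (Fin n) ℂ, LinearIndependent ℂ X ∧
      ∀ a, X a * w.1 = 0 ∧ w.2.1 * X a = 0 ∧ w.2.2 * X a = X a * w.2.2 := by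
  obtain ⟨h1, h2, h3⟩ := hw
  -- Level c ≥ k gives X ξ = 0 because ξ lives in the first k rows; c ≥ n - k gives η X = 0 because
  -- η lives in the last n - k columns.
  obtain ⟨X, hX, hX'⟩ := exists_linearIndependent_commute (c := max k (n - k))
    (v := w.2.2) fun i j h => h3 i j (by rw [Fin.le_def]; omega)
  refine ⟨X, hX, fun a => ⟨?_, ?_, (hX' a).2⟩⟩
  · ext i j
    rw [Matrix.mul_apply]
    refine Finset.sum_eq_zero fun m _ => ?_
    by_cases hm : k ≤ (m : ℕ)
    · rw [h1 m j hm, mul_zero]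
    · rw [(hX' a).1 i m (by omega), zero_mul]
  · ext i j
    rw [Matrix.mul_apply]
    refine Finset.sum_eq_zero fun m _ => ?_
    by_cases hm : (m : ℕ) < k
    · rw [h2 i m hm, zero_mul]
    · rw [(hX' a).1 m j (by omega), mul_zero]

end Centralizer

/-! ### Infinitesimal stabilizers bound the orbit dimension -/

section UpperBound

/-- A field embedding over a subring has relative transcendence degree at most that of the
subring, if the target is algebraic over the two images. -/
theorem trdeg_le_of_algHom {F K L : Type} [Field F] [Field K] [Field L] [Algebra F K]
    [Algebra K L] (R : Subalgebra F K) (θ : K →+* L)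
    (hR : ∀ x ∈ R, θ x = algebraMap K L x)
    (hgen : ∀ E : Subfield L, (∀ x : K, algebraMap K L x ∈ E) → (∀ x : K, θ x ∈ E) → E = ⊤) :
    Algebra.trdeg K L ≤ Algebra.trdeg R K := by
  have : FaithfulSMul R K := (faithfulSMul_iff_algebraMap_injective _ _).mpr Subtype.val_injective
  -- The images θ(s) suffice over K: θ(K) is algebraic over θ(R[s]), which lies in K[θ(s)] since θ
  -- is the identity on R, and K with θ(K) generates L.
  obtain ⟨s, hs⟩ := exists_isTranscendenceBasis R K
  have halg := hs.isAlgebraic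
  rw [Subtype.range_coe] at halg
  set S := Algebra.adjoin R s with hS
  set S' := Algebra.adjoin K (θ '' s) with hS'
  have hmem : ∀ x : S, θ x.1 ∈ S' := by
    rintro ⟨x, hx⟩
    induction hx using Algebra.adjoin_induction with
    | mem x hx => exact Algebra.subset_adjoin ⟨x, hx, rfl⟩
    | algebraMap r =>
      change θ r.1 ∈ S'
      rw [hR _ r.2]
      exact S'.algebraMap_mem _
    | add x y _ _ hx hy => simpa only [map_add] using add_mem hx hy
    | mul x y _ _ hx hy => simpa only [map_mul] using mul_mem hx hy
  let f : S →+* S' := (θ.comp S.val.toRingHom).codRestrict S'.toSubring hmem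
  have hf : Function.Injective f := fun x y h =>
    Subtype.ext (θ.injective (congrArg Subtype.val h))
  have hE := hgen (algSubfield S' L)
    (fun x => isAlgebraic_algebraMap (⟨_, S'.algebraMap_mem x⟩ : S'))
    (fun x => (halg.isAlgebraic x).ringHom_of_comp_eq f θ hf (RingHom.ext fun _ => rfl))
  have : Algebra.IsAlgebraic S' L :=
    ⟨fun x => mem_algSubfield.mp (hE ▸ Subfield.mem_top x)⟩
  refine (Algebra.IsAlgebraic.trdeg_le_cardinalMk K (θ '' s)).trans ?_
  refine Cardinal.mk_image_le.trans ?_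
  rw [hs.cardinalMk_eq_trdeg]

section Translate

variable {L : Type} [Field L] [Algebra (GenField n) L]

/-- A homomorphism from the function field of `GL_n` that translates the generic matrix by an
element stabilizing `w` fixes the coordinate ring of the orbit of `w`. -/
theorem eq_algebraMap_of_mem_orbitRing [Algebra ℂ L] [IsScalarTower ℂ (GenField n) L] {w : W n p q}
    {θ : GenField n →+* L} {T : Matrix (Fin n) (Fin n) L}
    (hθgen : (gen n).map θ = (gen n).map (algebraMap (GenField n) L) * (1 + T))
    (hθC : ∀ c : ℂ, θ (algebraMap ℂ _ c) = algebraMap ℂ L c)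
    (hT1 : T * baseChange L w.1 = 0) (hT2 : baseChange L w.2.1 * T = 0)
    (hT3 : baseChange L w.2.2 * T = T * baseChange L w.2.2) {x : GenField n} (hx : x ∈ orbitRing w) :
    θ x = algebraMap (GenField n) L x := by
  have hθext : ∀ {a b : Type} (A : Matrix a b ℂ), (baseChange (GenField n) A).map θ = baseChange L A := by
    intro a b A
    ext i j
    exact hθC _
  have hext : ∀ {a b : Type} (A : Matrix a b ℂ),
      (baseChange (GenField n) A).map (algebraMap (GenField n) L) = baseChange L A := by
    intro a b A
    ext i j
    exact (IsScalarTower.algebraMap_apply ℂ (GenField n) L _).symm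
  have hunit : IsUnit ((gen n).map θ).det := by
    rw [← RingHom.mapMatrix_apply, ← RingHom.map_det]
    exact isUnit_det_gen.map θ
  unfold orbitRing at hx
  induction hx using Algebra.adjoin_induction with
  | algebraMap c => rw [hθC, ← IsScalarTower.algebraMap_apply]
  | add x y _ _ hx hy => rw [map_add, map_add, hx, hy]
  | mul x y _ _ hx hy => rw [map_mul, map_mul, hx, hy]
  | mem x hx =>
    obtain ⟨a, rfl⟩ := hx
    rcases a with ⟨i, j⟩ | ⟨i, j⟩ | ⟨i, j⟩
    · have : (gen n * baseChange (GenField n) w.1).map θ =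
          (gen n * baseChange (GenField n) w.1).map (algebraMap (GenField n) L) := by
        rw [Matrix.map_mul, Matrix.map_mul, hθext, hext, hθgen, Matrix.mul_assoc,
          Matrix.add_mul, hT1, Matrix.one_mul, add_zero]
      exact congrFun (congrFun this i) j
    -- To avoid inverting 1 + T, both images of E are compared after right multiplication by the
    -- invertible image of the generic matrix under θ.
    · set E := baseChange (GenField n) w.2.1 * (gen n)⁻¹ with hE
      have h0 : E * gen n = baseChange (GenField n) w.2.1 :=
        Matrix.nonsing_inv_mul_cancel_right _ _ isUnit_det_gen
      have h1 : E.map θ * (gen n).map θ = baseChange L w.2.1 := by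
        rw [← Matrix.map_mul, h0, hθext]
      have h2 : E.map (algebraMap (GenField n) L) * (gen n).map θ = baseChange L w.2.1 := by
        rw [hθgen, ← Matrix.mul_assoc, ← Matrix.map_mul, h0, hext, Matrix.mul_add, hT2,
          Matrix.mul_one, add_zero]
      have : E.map θ = E.map (algebraMap (GenField n) L) := by
        rw [← Matrix.mul_nonsing_inv_cancel_right _ (E.map θ) hunit, h1, ← h2,
          Matrix.mul_nonsing_inv_cancel_right _ _ hunit]
      exact congrFun (congrFun this i) j
    · set E := gen n * baseChange (GenField n) w.2.2 * (gen n)⁻¹ with hE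
      have h0 : E * gen n = gen n * baseChange (GenField n) w.2.2 :=
        Matrix.nonsing_inv_mul_cancel_right _ _ isUnit_det_gen
      have h1 : E.map θ * (gen n).map θ = (gen n).map θ * baseChange L w.2.2 := by
        rw [← Matrix.map_mul, h0, Matrix.map_mul, hθext]
      have h2 : E.map (algebraMap (GenField n) L) * (gen n).map θ =
          (gen n).map θ * baseChange L w.2.2 := by
        rw [hθgen, ← Matrix.mul_assoc, ← Matrix.map_mul, h0, Matrix.map_mul, hext,
          Matrix.mul_assoc, Matrix.mul_assoc, Matrix.mul_add, Matrix.add_mul, hT3,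
          Matrix.mul_one, Matrix.one_mul]
      have : E.map θ = E.map (algebraMap (GenField n) L) := by
        rw [← Matrix.mul_nonsing_inv_cancel_right _ (E.map θ) hunit, h1, ← h2,
          Matrix.mul_nonsing_inv_cancel_right _ _ hunit]
      exact congrFun (congrFun this i) j

/-- T is recovered as gen⁻¹ · θ(gen) - 1, whose entries are combinations of elements of K and θ(K).
-/
theorem entriesIn_of_map_gen {θ : GenField n →+* L} {T : Matrix (Fin n) (Fin n) L}
    (hθgen : (gen n).map θ = (gen n).map (algebraMap (GenField n) L) * (1 + T))
    {E : Subfield L} (hE1 : ∀ x, algebraMap (GenField n) L x ∈ E) (hE2 : ∀ x, θ x ∈ E) :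
    EntriesIn E T := by
  have h1 : EntriesIn E ((gen n)⁻¹.map (algebraMap (GenField n) L) * (gen n).map θ) :=
    EntriesIn.mul (fun i j => hE1 _) fun i j => hE2 _
  have h2 : (gen n)⁻¹.map (algebraMap (GenField n) L) * (gen n).map θ = 1 + T := by
    rw [hθgen, ← Matrix.mul_assoc, ← Matrix.map_mul, Matrix.nonsing_inv_mul _ isUnit_det_gen,
      Matrix.map_one _ (map_zero _) (map_one _), Matrix.one_mul]
  intro i j
  have h3 := sub_mem (h1 i j) (show (1 : Matrix (Fin n) (Fin n) L) i j ∈ E by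
    rw [Matrix.one_apply]
    split_ifs
    · exact one_mem E
    · exact zero_mem E)
  rwa [h2, Matrix.add_apply, add_sub_cancel_left] at h3

end Translate

/-- The coefficients of a linear combination of linearly independent complex matrices lie in
any field that contains its entries. -/
theorem coeff_mem_of_entriesIn {L : Type} [Field L] [Algebra ℂ L] {E : Subfield L}
    (hE : ∀ c : ℂ, algebraMap ℂ L c ∈ E) {r : ℕ} {X : Fin r → Matrix (Fin n) (Fin n) ℂ}
    (hX : LinearIndependent ℂ X) {t : Fin r → L} (hT : EntriesIn E (∑ a, t a • baseChange L (X a)))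
    (a : Fin r) : t a ∈ E := by
  -- Ψ provides complex linear forms in the matrix entries that extract the coefficients; the same
  -- forms work over L.
  obtain ⟨Ψ, hΨ⟩ := LinearMap.exists_leftInverse_of_injective
    (Fintype.linearCombination ℂ X) (LinearMap.ker_eq_bot.mpr
      (linearIndependent_iff_injective_fintypeLinearCombination.mp hX))
  have hcoef : ∀ b, ∑ i, ∑ j, X b i j * Ψ (Matrix.single i j 1) a = if b = a then 1 else 0 := by
    intro b
    have h1 : Ψ (X b) = Pi.single b 1 := by
      have := LinearMap.congr_fun hΨ (Pi.single b 1)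
      simpa using this
    have h2 : Ψ (X b) a = ∑ i, ∑ j, X b i j * Ψ (Matrix.single i j 1) a := by
      conv_lhs => rw [Matrix.matrix_eq_sum_single (X b)]
      simp only [map_sum, Finset.sum_apply]
      refine Finset.sum_congr rfl fun i _ => Finset.sum_congr rfl fun j _ => ?_
      rw [← smul_eq_mul, ← Pi.smul_apply, ← map_smul, Matrix.smul_single, smul_eq_mul, mul_one]
    rw [← h2, h1, Pi.single_apply]
    simp only [eq_comm]
  have : t a = ∑ i, ∑ j, (∑ b, t b • baseChange L (X b)) i j *
      algebraMap ℂ L (Ψ (Matrix.single i j 1) a) := by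
    have h3 : ∀ i j, (∑ b, t b • baseChange L (X b)) i j * algebraMap ℂ L (Ψ (Matrix.single i j 1) a) =
        ∑ b, t b * algebraMap ℂ L (X b i j * Ψ (Matrix.single i j 1) a) := by
      intro i j
      simp only [Matrix.sum_apply, Matrix.smul_apply, Matrix.map_apply, smul_eq_mul,
        Finset.sum_mul, map_mul, mul_assoc]
    simp only [h3]
    rw [Finset.sum_congr rfl fun i _ => Finset.sum_comm, Finset.sum_comm]
    simp only [← Finset.mul_sum, ← map_sum, hcoef]
    simp
  rw [this]
  exact sum_mem fun i _ => sum_mem fun j _ => mul_mem (hT i j) (hE _)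

theorem sum_smul_ext_relations {L : Type} [Field L] [Algebra ℂ L] {r : ℕ} {w : W n p q}
    {X : Fin r → Matrix (Fin n) (Fin n) ℂ}
    (hw : ∀ a, X a * w.1 = 0 ∧ w.2.1 * X a = 0 ∧ w.2.2 * X a = X a * w.2.2) (t : Fin r → L) :
    (∑ a, t a • baseChange L (X a)) * baseChange L w.1 = 0 ∧ baseChange L w.2.1 * (∑ a, t a • baseChange L (X a)) = 0 ∧
      baseChange L w.2.2 * (∑ a, t a • baseChange L (X a)) = (∑ a, t a • baseChange L (X a)) * baseChange L w.2.2 := by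
  have hmap : ∀ {a b c : Type} [Fintype b] (A : Matrix a b ℂ) (B : Matrix b c ℂ),
      baseChange L A * baseChange L B = baseChange L (A * B) := fun A B => Matrix.map_mul.symm
  refine ⟨?_, ?_, ?_⟩
  · rw [Matrix.sum_mul]
    refine Finset.sum_eq_zero fun a _ => ?_
    rw [Matrix.smul_mul, hmap, (hw a).1]
    simp
  · rw [Matrix.mul_sum]
    refine Finset.sum_eq_zero fun a _ => ?_
    rw [Matrix.mul_smul, hmap, (hw a).2.1]
    simp
  · rw [Matrix.sum_mul, Matrix.mul_sum]
    refine Finset.sum_congr rfl fun a _ => ?_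
    rw [Matrix.mul_smul, Matrix.smul_mul, hmap, hmap, (hw a).2.2]

/-- The function field of `GL_n` with `r` additional variables admits a translation of the generic
matrix by a generic linear combination of `r` given matrices. -/
theorem exists_translation {r : ℕ} (X : Fin r → Matrix (Fin n) (Fin n) ℂ) :
    ∃ θ : GenField n →+* FractionRing (MvPolynomial (Fin r) (GenField n)),
      (gen n).map θ = (gen n).map (algebraMap (GenField n) _) *
        (1 + ∑ a, (algebraMap (MvPolynomial (Fin r) (GenField n))
          (FractionRing (MvPolynomial (Fin r) (GenField n))) (MvPolynomial.X a)) •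
            baseChange (FractionRing (MvPolynomial (Fin r) (GenField n))) (X a)) ∧
      ∀ c : ℂ, θ (algebraMap ℂ _ c) = algebraMap ℂ _ c := by
  set P := MvPolynomial (Fin r) (GenField n) with hP
  set Θ : Matrix (Fin n) (Fin n) P := (gen n).map (algebraMap (GenField n) P) *
    (1 + ∑ a, (MvPolynomial.X a : P) • (X a).map (algebraMap ℂ P)) with hΘ
  set φ : MvPolynomial (Fin n × Fin n) ℂ →ₐ[ℂ] P := MvPolynomial.aeval fun x => Θ x.1 x.2 with hφ
  -- Setting the new variables to 0 turns φ into the inclusion of the polynomial ring in its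
  -- fraction field.
  have hφinj : Function.Injective φ := by
    have hcomp : (MvPolynomial.constantCoeff : P →+* GenField n).comp φ.toRingHom =
        algebraMap (MvPolynomial (Fin n × Fin n) ℂ) (GenField n) := by
      refine MvPolynomial.ringHom_ext (fun c => ?_) fun ij => ?_
      · change MvPolynomial.constantCoeff (φ (algebraMap ℂ _ c)) = _
        rw [AlgHom.commutes, IsScalarTower.algebraMap_apply ℂ (GenField n) P]
        exact (MvPolynomial.constantCoeff_C _ _).trans
          (IsScalarTower.algebraMap_apply ℂ (MvPolynomial (Fin n × Fin n) ℂ) (GenField n) c)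
      · change MvPolynomial.constantCoeff (φ (MvPolynomial.X ij)) = _
        rw [hφ, MvPolynomial.aeval_X, hΘ, Matrix.mul_apply, map_sum]
        rw [Finset.sum_eq_single ij.2]
        · simp [gen, Matrix.sum_apply]
          exact MvPolynomial.constantCoeff_C _ _
        · intro b _ hb
          simp [Matrix.sum_apply, hb]
        · simp
    refine Function.Injective.of_comp (f := (MvPolynomial.constantCoeff : P →+* GenField n)) ?_
    have : (MvPolynomial.constantCoeff : P →+* GenField n) ∘ φ =
        algebraMap (MvPolynomial (Fin n × Fin n) ℂ) (GenField n) := by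
      rw [← hcomp]
      rfl
    rw [this]
    exact IsFractionRing.injective _ _
  have hinj : Function.Injective ((algebraMap P (FractionRing P)).comp φ.toRingHom) :=
    (IsFractionRing.injective P (FractionRing P)).comp hφinj
  refine ⟨IsFractionRing.lift hinj, ?_, ?_⟩
  · ext i j
    have h1 : IsFractionRing.lift hinj (gen n i j) =
        algebraMap P (FractionRing P) (φ (MvPolynomial.X (i, j))) := by
      exact IsFractionRing.lift_algebraMap hinj _
    rw [Matrix.map_apply, h1, hφ, MvPolynomial.aeval_X, hΘ, Matrix.mul_apply, Matrix.mul_apply,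
      map_sum]
    refine Finset.sum_congr rfl fun m _ => ?_
    rw [map_mul]
    congr 1
    simp only [Matrix.add_apply, Matrix.sum_apply, map_add, map_sum, Matrix.smul_apply,
      Matrix.map_apply, smul_eq_mul, map_mul, Matrix.one_apply]
    congr 1
    split_ifs <;> simp
  · intro c
    have h1 : IsFractionRing.lift hinj (algebraMap ℂ (GenField n) c) =
        algebraMap P (FractionRing P) (φ (algebraMap ℂ _ c)) := by
      rw [IsScalarTower.algebraMap_apply ℂ (MvPolynomial (Fin n × Fin n) ℂ) (GenField n)]
      exact IsFractionRing.lift_algebraMap hinj _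
    rw [h1, AlgHom.commutes, ← IsScalarTower.algebraMap_apply]

/-- With T = Σ t_a X_a, the relations make 1 + T stabilize w, so translating the generic matrix by
it fixes the orbit ring. Independence of the X_a recovers each t_a from K and θ(K), so
`trdeg_le_of_algHom` bounds r = trdeg K(t)/K by the degree of K over the orbit ring. -/
theorem le_trdeg_orbitRing {r : ℕ} {w : W n p q} {X : Fin r → Matrix (Fin n) (Fin n) ℂ}
    (hX : LinearIndependent ℂ X)
    (hw : ∀ a, X a * w.1 = 0 ∧ w.2.1 * X a = 0 ∧ w.2.2 * X a = X a * w.2.2) :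
    (r : Cardinal) ≤ Algebra.trdeg (orbitRing w) (GenField n) := by
  obtain ⟨θ, hθgen, hθC⟩ := exists_translation X
  have hmain : Algebra.trdeg (GenField n) (FractionRing (MvPolynomial (Fin r) (GenField n))) ≤
      Algebra.trdeg (orbitRing w) (GenField n) := by
    obtain ⟨h1, h2, h3⟩ := sum_smul_ext_relations hw fun a =>
      algebraMap (MvPolynomial (Fin r) (GenField n))
        (FractionRing (MvPolynomial (Fin r) (GenField n))) (MvPolynomial.X a)
    refine trdeg_le_of_algHom (orbitRing w) θ (fun x hx =>
      eq_algebraMap_of_mem_orbitRing hθgen hθC h1 h2 h3 hx) fun E hE1 hE2 => ?_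
    · have hEC : ∀ c : ℂ, algebraMap ℂ _ c ∈ E := fun c => by
        rw [← hθC]
        exact hE2 _
      exact eq_top_iff.mpr fun x _ => mem_subfield_of_fractionRing E (fun c => hE1 c)
        (coeff_mem_of_entriesIn hEC hX (entriesIn_of_map_gen hθgen hE1 hE2)) x
  refine le_trans (le_of_eq ?_) hmain
  have : Algebra.IsAlgebraic (MvPolynomial (Fin r) (GenField n))
      (FractionRing (MvPolynomial (Fin r) (GenField n))) :=
    IsLocalization.isAlgebraic _ (nonZeroDivisors _)
  rw [← trdeg_add_eq (GenField n) (MvPolynomial (Fin r) (GenField n)),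
    MvPolynomial.trdeg_of_isDomain,
    trdeg_eq_zero (R := MvPolynomial (Fin r) (GenField n))]
  simp

end UpperBound

end EnhancedAdjoint

/-! ### Both dimension bounds -/

namespace EnhancedAdjoint

open Matrix

section Dimension

variable {n p q k : ℕ}

theorem le_sub_of_add_eq {d t : Cardinal} {N r : ℕ} (h : d + t = (N : Cardinal))
    (ht : (r : Cardinal) ≤ t) : d ≤ ((N - r : ℕ) : Cardinal) := by
  obtain ⟨a, rfl⟩ := Cardinal.lt_aleph0.mp
    ((le_self_add.trans_eq h).trans_lt (Cardinal.natCast_lt_aleph0 (n := N)))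
  obtain ⟨b, rfl⟩ := Cardinal.lt_aleph0.mp
    ((le_add_self.trans_eq h).trans_lt (Cardinal.natCast_lt_aleph0 (n := N)))
  norm_cast at *
  omega

theorem sub_le_of_add_eq {d t : Cardinal} {N r : ℕ} (h : d + t = (N : Cardinal))
    (ht : t ≤ (r : Cardinal)) : ((N - r : ℕ) : Cardinal) ≤ d := by
  obtain ⟨a, rfl⟩ := Cardinal.lt_aleph0.mp
    ((le_self_add.trans_eq h).trans_lt (Cardinal.natCast_lt_aleph0 (n := N)))
  obtain ⟨b, rfl⟩ := Cardinal.lt_aleph0.mp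
    ((le_add_self.trans_eq h).trans_lt (Cardinal.natCast_lt_aleph0 (n := N)))
  norm_cast at *
  omega

theorem varDim_orbit_le (hk : k ≤ n) {w : W n p q} (hw : w ∈ component n p q k) :
    varDim (orbit w) ≤ ((n ^ 2 - min k (n - k) : ℕ) : Cardinal) := by
  obtain ⟨g, u, hu, rfl⟩ := hw
  rw [orbit_act]
  obtain ⟨X, hX, hX'⟩ := exists_linearIndependent_stabilizer hk hu
  have h := le_sub_of_add_eq (varDim_orbit_add u) (le_trdeg_orbitRing hX hX')
  rwa [show n - max k (n - k) = min k (n - k) by omega] at h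

theorem le_varDim_orbit_jordanSlice {z : Fin p} {ι : Type*} {e : ι ≃ SliceIndex n p q k z}
    (hk : k ≤ n) (hkk : n - k ≤ k) (k1 : 1 ≤ k) (c : ι → ℂ) :
    ((n ^ 2 - min k (n - k) : ℕ) : Cardinal) ≤ varDim (orbit (jordanSlice e c)) := by
  rw [min_eq_right hkk]
  exact sub_le_of_add_eq (varDim_orbit_add _) (trdeg_orbitRing_le (z := z) hk hkk k1 rfl
    fun i => by simp [jordanSlice])

end Dimension

/-! ### Duality between k and n - k -/

section Duality

/-- The duality `(B, C, A) ↦ (Cᵀ, Bᵀ, Aᵀ)`, with the order of the basis reversed. -/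
def dualMap (n p q : ℕ) : W n p q →ₗ[ℂ] W n q p where
  toFun w := (w.2.1ᵀ.submatrix Fin.rev id, w.1ᵀ.submatrix id Fin.rev,
    w.2.2ᵀ.submatrix Fin.rev Fin.rev)
  map_add' _ _ := rfl
  map_smul' _ _ := rfl

variable {n p q k : ℕ}

theorem dual_dual (w : W n p q) : dualMap n q p (dualMap n p q w) = w := by
  refine Prod.ext ?_ (Prod.ext ?_ ?_)
  · ext i j
    change w.1 (Fin.rev (Fin.rev i)) j = w.1 i j
    rw [Fin.rev_rev]
  · ext i j
    change w.2.1 i (Fin.rev (Fin.rev j)) = w.2.1 i j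
    rw [Fin.rev_rev]
  · ext i j
    change w.2.2 (Fin.rev (Fin.rev i)) (Fin.rev (Fin.rev j)) = w.2.2 i j
    rw [Fin.rev_rev, Fin.rev_rev]

/-- The automorphism of `GL_n` corresponding to the duality. -/
def dualGL (g : Matrix.GeneralLinearGroup (Fin n) ℂ) : Matrix.GeneralLinearGroup (Fin n) ℂ where
  val := ((g⁻¹ : Matrix.GeneralLinearGroup (Fin n) ℂ) :
    Matrix (Fin n) (Fin n) ℂ)ᵀ.submatrix Fin.revPerm Fin.revPerm
  inv := (g : Matrix (Fin n) (Fin n) ℂ)ᵀ.submatrix Fin.revPerm Fin.revPerm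
  val_inv := by
    rw [Matrix.submatrix_mul_equiv, ← Matrix.transpose_mul, Units.mul_inv, Matrix.transpose_one,
      Matrix.submatrix_one_equiv]
  inv_val := by
    rw [Matrix.submatrix_mul_equiv, ← Matrix.transpose_mul, Units.inv_mul, Matrix.transpose_one,
      Matrix.submatrix_one_equiv]

theorem dual_act (g : Matrix.GeneralLinearGroup (Fin n) ℂ) (w : W n p q) :
    dualMap n p q (act g w) = act (dualGL g) (dualMap n p q w) := by
  refine Prod.ext ?_ (Prod.ext ?_ ?_)
  · change (w.2.1 * _)ᵀ.submatrix Fin.revPerm (Equiv.refl _) =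
      (_ᵀ.submatrix Fin.revPerm Fin.revPerm) * w.2.1ᵀ.submatrix Fin.revPerm (Equiv.refl _)
    rw [Matrix.submatrix_mul_equiv, ← Matrix.transpose_mul]
  · change ((g : Matrix (Fin n) (Fin n) ℂ) * w.1)ᵀ.submatrix (Equiv.refl _) Fin.revPerm =
      w.1ᵀ.submatrix (Equiv.refl _) Fin.revPerm * (_ᵀ.submatrix Fin.revPerm Fin.revPerm)
    rw [Matrix.submatrix_mul_equiv, ← Matrix.transpose_mul]
  · change ((g : Matrix (Fin n) (Fin n) ℂ) * w.2.2 * _)ᵀ.submatrix Fin.revPerm Fin.revPerm =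
      (_ᵀ.submatrix Fin.revPerm Fin.revPerm) * w.2.2ᵀ.submatrix Fin.revPerm Fin.revPerm *
        (_ᵀ.submatrix Fin.revPerm Fin.revPerm)
    rw [Matrix.submatrix_mul_equiv, Matrix.submatrix_mul_equiv, ← Matrix.transpose_mul,
      ← Matrix.transpose_mul, ← Matrix.mul_assoc]

theorem dual_mem_component (hk : k ≤ n) {w : W n p q} (hw : w ∈ component n p q k) :
    dualMap n p q w ∈ component n q p (n - k) := by
  obtain ⟨g, u, ⟨h1, h2, h3⟩, rfl⟩ := hw
  refine ⟨dualGL g, dualMap n p q u, ⟨fun i j h => ?_, fun i j h => ?_, fun i j h => ?_⟩,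
    dual_act g u⟩
  · exact h2 j (Fin.rev i) (by rw [Fin.val_rev]; omega)
  · exact h1 (Fin.rev j) i (by rw [Fin.val_rev]; omega)
  · exact h3 (Fin.rev j) (Fin.rev i) (Fin.rev_le_rev.mpr h)

theorem dual_mem_component_iff (hk : k ≤ n) {w : W n q p} :
    dualMap n q p w ∈ component n p q k ↔ w ∈ component n q p (n - k) := by
  constructor
  · intro h
    have := dual_mem_component hk h
    rwa [dual_dual] at this
  · intro h
    have := dual_mem_component (Nat.sub_le n k) h
    rwa [Nat.sub_sub_self hk] at this

theorem dual_mem_orbit {w x : W n p q} (h : x ∈ orbit w) :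
    dualMap n p q x ∈ orbit (dualMap n p q w) := by
  obtain ⟨g, rfl⟩ := h
  exact ⟨dualGL g, (dual_act g w).symm⟩

theorem dual_mem_orbit_iff {w : W n p q} {x : W n q p} :
    dualMap n q p x ∈ orbit w ↔ x ∈ orbit (dualMap n p q w) := by
  constructor
  · intro h
    have := dual_mem_orbit h
    rwa [dual_dual] at this
  · intro h
    have := dual_mem_orbit h
    rwa [dual_dual] at this

/-- Pullback along the linear involution identifies the two coordinate rings. -/
theorem varDim_le_of_dual (w : W n p q) :
    varDim (orbit w) ≤ varDim (orbit (dualMap n p q w)) := by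
  let φ : (orbit w → ℂ) →ₐ[ℂ] (orbit (dualMap n p q w) → ℂ) :=
    { toFun := fun f x => f ⟨dualMap n q p x, dual_mem_orbit_iff.mpr x.2⟩
      map_one' := rfl
      map_mul' := fun _ _ => rfl
      map_zero' := rfl
      map_add' := fun _ _ => rfl
      commutes' := fun _ => rfl }
  have hφ : (coordRing (orbit w)).map φ = coordRing (orbit (dualMap n p q w)) := by
    rw [coordRing, AlgHom.map_adjoin, coordRing]
    congr 1
    ext f
    constructor
    · rintro ⟨_, ⟨l, rfl⟩, rfl⟩
      exact ⟨l ∘ₗ dualMap n q p, rfl⟩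
    · rintro ⟨l, rfl⟩
      refine ⟨_, ⟨l ∘ₗ dualMap n p q, rfl⟩, ?_⟩
      ext x
      change l (dualMap n p q (dualMap n q p x)) = l x
      rw [dual_dual]
  have h := trdeg_map_eq (coordRing (orbit w)) φ fun f _ hf => by
    ext ⟨x, hx⟩
    have := congrFun hf ⟨dualMap n p q x, dual_mem_orbit hx⟩
    change f ⟨dualMap n q p (dualMap n p q x), _⟩ = 0 at this
    simp only [dual_dual] at this
    exact this
  rw [hφ] at h
  exact h.le

theorem IsRegularOn.comp_linear {X Y Z : Type*} [AddCommGroup X] [Module ℂ X] [AddCommGroup Y]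
    [Module ℂ Y] [AddCommGroup Z] [Module ℂ Z] {S : Set X} {T : Set Y} {f : Y → Z}
    (hf : IsRegularOn T f) (F : X →ₗ[ℂ] Y) (hF : Set.MapsTo F S T) :
    IsRegularOn S fun x => f (F x) := fun l x hx =>
  regAt_comp_linear F hF (hf l (F x) (hF hx))

theorem IsRegularOn.linear_comp {X Y Z : Type*} [AddCommGroup X] [Module ℂ X] [AddCommGroup Y]
    [Module ℂ Y] [AddCommGroup Z] [Module ℂ Z] {S : Set X} {f : X → Y}
    (hf : IsRegularOn S f) (F : Y →ₗ[ℂ] Z) : IsRegularOn S fun x => F (f x) := fun l =>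
  hf (l ∘ₗ F)

/-- All data are conjugated by the linear involution `dualMap`; equivariance survives because
`dualMap` intertwines the actions through the involutive automorphism `dualGL`. -/
theorem IsFibration.dual {M : Type*} [AddCommGroup M] [Module ℂ M] {Ω : Set (W n p q)}
    {f : W n p q → M} {w : W n p q} (h : IsFibration Ω f (orbit w)) :
    IsFibration {x | dualMap n q p x ∈ Ω} (fun x => f (dualMap n q p x))
      (orbit (dualMap n p q w)) := by
  obtain ⟨hf, hloc⟩ := h
  refine ⟨hf.comp_linear (dualMap n q p) fun x hx => hx, fun b => ?_⟩
  obtain ⟨N, hb, hN, e, ⟨he, hmaps, e', he', hmaps', hinv⟩, hfe, hact⟩ := hloc b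
  refine ⟨N, hb, hN, fun x => dualMap n p q (e (dualMap n q p x.1, x.2)),
    ⟨?_, ?_, fun x => (dualMap n p q (e' (dualMap n q p x)).1,
      (e' (dualMap n q p x)).2), ?_, ?_, ?_, ?_⟩, ?_, ?_⟩
  · exact (he.comp_linear ((dualMap n q p).prodMap LinearMap.id)
      fun x hx => ⟨dual_mem_orbit_iff.mpr hx.1, hx.2⟩).linear_comp (dualMap n p q)
  · rintro x ⟨hx1, hx2⟩
    have := hmaps (show (dualMap n q p x.1, x.2) ∈ orbit w ×ˢ N from
      ⟨dual_mem_orbit_iff.mpr hx1, hx2⟩)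
    simpa only [Set.mem_ofPred_eq, dual_dual] using this
  · exact (he'.comp_linear (dualMap n q p) fun x hx => hx).linear_comp
      ((dualMap n p q).prodMap LinearMap.id)
  · intro x hx
    have := hmaps' (show dualMap n q p x ∈ {x | x ∈ Ω ∧ f x ∈ N} from hx)
    exact ⟨dual_mem_orbit this.1, this.2⟩
  · rintro ⟨x, c⟩ ⟨hx, hc⟩
    have := hinv.1 (show (dualMap n q p x, c) ∈ orbit w ×ˢ N from
      ⟨dual_mem_orbit_iff.mpr hx, hc⟩)
    simp only [dual_dual, this]
  · intro x hx
    have := hinv.2 (show dualMap n q p x ∈ {x | x ∈ Ω ∧ f x ∈ N} from hx)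
    simp only [dual_dual, Prod.mk.eta, this]
  · intro x hx c hc
    simp only [dual_dual]
    exact hfe _ (dual_mem_orbit_iff.mpr hx) c hc
  · intro g x hx c hc
    have h1 := hact (dualGL g) _ (dual_mem_orbit_iff.mpr hx) c hc
    have h2 : dualGL (dualGL g) = g := by
      ext i j
      change (g : Matrix (Fin n) (Fin n) ℂ) (Fin.rev (Fin.rev i)) (Fin.rev (Fin.rev j)) = _
      rw [Fin.rev_rev, Fin.rev_rev]
    simp only [dual_act, h1, h2]

end Duality

/-! ### Assembly of the fibration and the main theorem -/

section Main

variable {n p q k m : ℕ}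

/-- An open dense subset of the component is fibered by isomorphic orbits of the largest
dimension, with base an affine space of dimension `m`. -/
def HasFibration (n p q k m : ℕ) : Prop :=
  ∃ Ω : Set (W n p q), IsZariskiOpenIn (component n p q k) Ω ∧
    component n p q k ⊆ zariskiClosure Ω ∧
    ∃ f : W n p q → (Fin m → ℂ),
      (∃ w₀ ∈ component n p q k, IsFibration Ω f (orbit w₀)) ∧
      ∀ b, ∃ w ∈ component n p q k, {x ∈ Ω | f x = b} = orbit w ∧
        ((n ^ 2 - min k (n - k) : ℕ) : Cardinal) ≤ varDim (orbit w)

theorem HasFibration.dual (hk : k ≤ n) (h : HasFibration n p q k m) :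
    HasFibration n q p (n - k) m := by
  obtain ⟨Ω, ⟨F, hF, hΩ⟩, hdense, f, ⟨w₀, hw₀, hfib⟩, hfiber⟩ := h
  refine ⟨{x | dualMap n q p x ∈ Ω},
    ⟨(fun f x => f (dualMap n q p x)) '' F, ?_, ?_⟩, ?_, _,
    ⟨_, dual_mem_component hk hw₀, hfib.dual⟩, fun b => ?_⟩
  · rintro _ ⟨φ, hφ, rfl⟩
    exact polyFun_comp_linear _ (hF hφ)
  · ext x
    rw [Set.mem_ofPred_eq, hΩ]
    simp only [Set.mem_ofPred_eq, dual_mem_component_iff hk, Set.exists_mem_image]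
  · intro x hx φ hφ hvan
    have := hdense ((dual_mem_component_iff hk).mpr hx) (fun y => φ (dualMap n p q y))
      (polyFun_comp_linear _ hφ) fun y hy => hvan _ (by rwa [Set.mem_ofPred_eq, dual_dual])
    simpa only [dual_dual] using this
  · obtain ⟨w, hw, hfw, hdim⟩ := hfiber b
    refine ⟨dualMap n p q w, dual_mem_component hk hw, ?_, ?_⟩
    · ext x
      rw [← dual_mem_orbit_iff, ← hfw]
      rfl
    · rw [Nat.sub_sub_self hk, min_comm]
      exact hdim.trans (varDim_le_of_dual w)

theorem card_sliceIndex (hk : k ≤ n) (z : Fin p) :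
    Fintype.card (SliceIndex n p q k z) = k * (p - 1) + q * (n - k) := by
  have h1 : Fintype.card {i : Fin n // (i : ℕ) < k} = k := by
    rw [Fintype.card_congr (⟨fun i => ⟨i.1, i.2⟩, fun i => ⟨Fin.castLE hk i, i.2⟩,
      fun _ => rfl, fun _ => rfl⟩ : {i : Fin n // (i : ℕ) < k} ≃ Fin k), Fintype.card_fin]
  have h2 : Fintype.card {i : Fin n // k ≤ (i : ℕ)} = n - k := by
    have := Fintype.card_subtype_compl fun i : Fin n => (i : ℕ) < k
    simp only [not_lt] at this
    rw [this, h1, Fintype.card_fin]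
  have h3 : Fintype.card {j : Fin p // j ≠ z} = p - 1 := by
    have := Fintype.card_subtype_compl fun j : Fin p => j = z
    rw [this, Fintype.card_fin, Fintype.card_subtype_eq]
  rw [Fintype.card_sum, Fintype.card_prod, Fintype.card_prod, h1, h2, h3, Fintype.card_fin]

theorem hasFibration_of_le (hp : 1 ≤ p) (hk : k ≤ n) (hkk : n - k ≤ k) (k1 : 1 ≤ k)
    (hm : m = k * p + q * (n - k) - k) : HasFibration n p q k m := by
  have hcard : Fintype.card (Fin m) = Fintype.card (SliceIndex n p q k ⟨0, hp⟩) := by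
    obtain ⟨p, rfl⟩ := Nat.exists_eq_add_of_le' hp
    rw [card_sliceIndex hk, Fintype.card_fin, hm, Nat.add_sub_cancel, Nat.mul_succ]
    omega
  have e := Fintype.equivOfCardEq hcard
  have hs := isSlice_jordanSlice (e := e) hk hkk k1
  obtain ⟨f, hf, hfiber⟩ := hs.exists_isFibration 0
  have hmem : ∀ c, jordanSlice e c ∈ component n p q k := fun c =>
    saturation_jordanSlice_subset ⟨1, c, (act_one _).symm⟩
  exact ⟨_, isZariskiOpenIn_saturation hk k1, component_subset_zariskiClosure hk k1, f,
    ⟨_, hmem 0, hf⟩, fun b => ⟨_, hmem b, hfiber b, le_varDim_orbit_jordanSlice hk hkk k1 b⟩⟩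

/-- For n = 0 the Jordan slice is unavailable, as no column can be normalized to a k-th basis
vector; but W is a point and the constant slice works. -/
theorem hasFibration_zero : HasFibration 0 p q 0 0 := by
  have hs : IsSlice (fun _ : Fin 0 → ℂ => (0 : W 0 p q)) := by
    refine ⟨fun l => (polyFun _).algebraMap_mem (l 0), ⟨0, fun c => Subsingleton.elim _ _⟩,
      fun _ _ _ _ _ => Subsingleton.elim _ _, fun _ _ _ _ => Subsingleton.elim _ _,
      fun x₀ _ => ⟨fun _ => 1, MatIn.const _, 1, one_mem _, one_ne_zero, fun x _ _ =>
        ⟨1, rfl, 0, Subsingleton.elim _ _⟩⟩⟩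
  obtain ⟨f, hf, hfiber⟩ := hs.exists_isFibration 0
  have hcomp : ∀ x : W 0 p q, x ∈ component 0 p q 0 := fun x =>
    ⟨1, 0, ⟨fun i => i.elim0, fun _ i => i.elim0, fun i => i.elim0⟩, Subsingleton.elim _ _⟩
  have hsat : ∀ x : W 0 p q, x ∈ saturation (fun _ : Fin 0 → ℂ => (0 : W 0 p q)) := fun x =>
    ⟨1, 0, Subsingleton.elim _ _⟩
  refine ⟨_, ⟨{1}, by simp, ?_⟩, fun x _ φ _ h => h x (hsat x), f,
    ⟨_, hcomp _, hf⟩, fun b => ⟨_, hcomp _, hfiber b, by simp⟩⟩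
  ext x
  simp [hcomp, hsat]

theorem hasFibration (hp : 1 ≤ p) (hq : 1 ≤ q) (hk : k ≤ n) :
    HasFibration n p q k (k * p + q * (n - k) - max k (n - k)) := by
  rcases Nat.eq_zero_or_pos n with rfl | hn
  · obtain rfl : k = 0 := by omega
    simpa using hasFibration_zero
  · rcases le_total (n - k) k with h | h
    · exact hasFibration_of_le hp hk h (by omega) (by rw [max_eq_left h])
    · have := (hasFibration_of_le (n := n) (p := q) (q := p) (k := n - k)
        (m := k * p + q * (n - k) - max k (n - k)) hq (Nat.sub_le _ _) (by omega) (by omega)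
        (by rw [max_eq_right h, Nat.sub_sub_self hk, mul_comm k, mul_comm q, add_comm])).dual
          (Nat.sub_le _ _)
      rwa [Nat.sub_sub_self hk] at this

end Main

end EnhancedAdjoint

theorem mainTheorem4 (n p q k : ℕ) (hp : 1 ≤ p) (hq : 1 ≤ q) (hk : k ≤ n) :
    -- the largest dimension of a nilpotent orbit in the component
    IsGreatest
      {d : Cardinal | ∃ w ∈ EnhancedAdjoint.component n p q k,
        w ∈ EnhancedAdjoint.nullCone n p q ∧ d = EnhancedAdjoint.varDim (EnhancedAdjoint.orbit w)}
      ((n ^ 2 - min k (n - k) : ℕ) : Cardinal) ∧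
    -- the fibration of an open dense subset by isomorphic orbits of the largest dimension
    (∃ Ω : Set (EnhancedAdjoint.W n p q),
      EnhancedAdjoint.IsZariskiOpenIn (EnhancedAdjoint.component n p q k) Ω ∧
      EnhancedAdjoint.component n p q k ⊆ EnhancedAdjoint.zariskiClosure Ω ∧
      ∃ f : EnhancedAdjoint.W n p q → (Fin (k * p + q * (n - k) - max k (n - k)) → ℂ),
        (∃ w₀ ∈ EnhancedAdjoint.component n p q k,
          EnhancedAdjoint.IsFibration Ω f (EnhancedAdjoint.orbit w₀)) ∧
        ∀ b, ∃ w ∈ EnhancedAdjoint.component n p q k,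
          w ∈ EnhancedAdjoint.nullCone n p q ∧
          {x ∈ Ω | f x = b} = EnhancedAdjoint.orbit w ∧
          EnhancedAdjoint.varDim (EnhancedAdjoint.orbit w) =
            ((n ^ 2 - min k (n - k) : ℕ) : Cardinal)) ∧
    -- the components that contain a nilpotent orbit of dimension `n²`
    ((∃ w ∈ EnhancedAdjoint.component n p q k,
        w ∈ EnhancedAdjoint.nullCone n p q ∧
        EnhancedAdjoint.varDim (EnhancedAdjoint.orbit w) = ((n ^ 2 : ℕ) : Cardinal)) ↔
      (k = 0 ∨ k = n)) := by
  obtain ⟨Ω, hopen, hdense, f, hfib, hfiber⟩ := EnhancedAdjoint.hasFibration hp hq hk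
  have hdim : ∀ w ∈ EnhancedAdjoint.component n p q k,
      ((n ^ 2 - min k (n - k) : ℕ) : Cardinal) ≤
        EnhancedAdjoint.varDim (EnhancedAdjoint.orbit w) →
      EnhancedAdjoint.varDim (EnhancedAdjoint.orbit w) =
        ((n ^ 2 - min k (n - k) : ℕ) : Cardinal) := fun w hw h =>
    le_antisymm (EnhancedAdjoint.varDim_orbit_le hk hw) h
  obtain ⟨w₁, hw₁, -, hd₁⟩ := hfiber 0
  refine ⟨⟨⟨w₁, hw₁, EnhancedAdjoint.component_subset_nullCone hw₁, (hdim w₁ hw₁ hd₁).symm⟩, ?_⟩,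
    ⟨Ω, hopen, hdense, f, hfib, fun b => ?_⟩, ?_, ?_⟩
  · rintro d ⟨w, hw, -, rfl⟩
    exact EnhancedAdjoint.varDim_orbit_le hk hw
  · obtain ⟨w, hw, hfw, hd⟩ := hfiber b
    exact ⟨w, hw, EnhancedAdjoint.component_subset_nullCone hw, hfw, hdim w hw hd⟩
  · rintro ⟨w, hw, -, hd⟩
    have h := EnhancedAdjoint.varDim_orbit_le hk hw
    rw [hd, Nat.cast_le] at h
    -- Ensures min(k, n-k) ≤ n², so that the truncated subtraction is a true one and the minimum
    -- must be 0.
    have hsq : n ≤ n ^ 2 := Nat.le_self_pow two_ne_zero n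
    omega
  · intro h
    refine ⟨w₁, hw₁, EnhancedAdjoint.component_subset_nullCone hw₁, ?_⟩
    rw [hdim w₁ hw₁ hd₁, show min k (n - k) = 0 by omega, Nat.sub_zero]
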